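/- Let $\mathcal X$ be a measurable space and $\mathcal H_k$ a real reproducing kernel Hilbert space of functions on $\mathcal X$ with (jointly) measurable kernel $k$. Let $P$ be the joint distribution of $(X,Y)\in\mathcal X\times\mathbb R$, let $P_X$ be its $X$-marginal and $\bar f(x)=\mathbb E[Y\mid X=x]$. Assume (B) $Y\in[-1,1]$ almost surely and $k(x,x)\le 1$ for all $x\in\mathcal X$; (U) for every probability distribution $Q$ on $\mathcal X$, $\mathcal H_k$ is dense in $L_2(Q)$. Let $(X_1,Y_1),(X_2,Y_2),\dots$ be independent with law $P$. For given $n$ and a response vector $\mathbf y\in\mathbb R^n$ put $$T^*v=\frac1n\sum_{i=1}^n v_i\,k(X_i,\cdot)\quad(v\in\mathbb R^n),\qquad Tg=(g(X_1),\dots,g(X_n))\quad(g\in\mathcal H_k),\qquad S=T^*T .$$ Empirical kernel PLS (KPLS) is the conjugate gradient iteration in $\mathcal H_k$ given by $g_0=0$, $u_0=d_0=T^*\mathbf y$ and, for $m\ge 0$, $$\alpha_m=\frac{\|u_m\|^2}{\langle d_m,Sd_m\rangle},\quad g_{m+1}=g_m+\alpha_m d_m,\quad u_{m+1}=u_m-\alpha_m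 S d_m,\quad \beta_m=\frac{\|u_{m+1}\|^2}{\|u_m\|^2},\quad d_{m+1}=u_{m+1}+\beta_m d_m .$$ Let $K=TT^*$, that is, the matrix $\big(\tfrac1n k(X_i,X_j)\big)_{i,j\le n}$, let $\langle v,w\rangle_n=\frac1n\sum_{i=1}^n v_iw_i$, and let $M_m$ and $M'_m$ be the $m\times m$ matrices with entries $$(M_m)_{ij}=\langle \mathbf y,K^{i+j}\mathbf y\rangle_n,\qquad (M'_m)_{ij}=\langle \mathbf y,K^{i+j-1}\mathbf y\rangle_n\qquad(1\le i,j\le m).$$ Here $\|\cdot\|$ is the Euclidean operator norm on matrices, and $\|M_m^{-1}\|=\infty$ if $M_m$ is singular. Fix $0<\nu<\frac12$, let $m'_{(n)}+1$ be the first $m\ge1$ with $$m\,\big(\max(\|M'_m\|,m^{-1})\,\|M_m^{-1}\|\big)^2\ge n^\nu ,$$ and let $f^{(n)}=g_{m'_{(n)}}$ be the KPLS estimate at the step before that time. (i) With the responses $\mathbf y=(Y_1,\dots,Y_n)$, almost surely $$\lim_{n\to\infty}\|\bar f-f^{(n)}\|_{L_2(P_X)}=0 .$$ (ii) With the empirically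 centred responses $\mathbf y=\big(Y_i-\tfrac1n\sum_{j=1}^n Y_j\big)_{i\le n}$, almost surely $$\lim_{n\to\infty}\|(\bar f-\mathbb E Y)-f^{(n)}\|_{L_2(P_X)}=0 ;$$ in particular $f^{(n)}\to\bar f$ in $L_2(P_X)$ almost surely if $\mathbb E Y=0$. -/

import Mathlib

open MeasureTheory ProbabilityTheory Filter Topology
open scoped ENNReal

noncomputable section

namespace KPLS

section Kernel

variable {X : Type*} (H : Type*) [NormedAddCommGroup H] [InnerProductSpace ℝ H] [CompleteSpace H]
  [RKHS ℝ H X ℝ]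

/-- The canonical kernel mapping `φ(x) = k(x, ·)` into the reproducing kernel Hilbert space. -/
def feature (x : X) : H := RKHS.kerFun H x 1

/-- The real-valued reproducing kernel `k(x, x')` of `H`. -/
def realKernel (x x' : X) : ℝ := RKHS.kernel H x x' 1

/-- Universality: for every probability distribution `Q` on `X`, (the classes of) the functions
in `H` are dense in `L²(Q)`. -/
def IsUniversal [MeasurableSpace X] : Prop :=
  ∀ Q : Measure X, IsProbabilityMeasure Q →
    Dense {f : Lp ℝ 2 Q | ∃ g : H, (f : X → ℝ) =ᵐ[Q] (g : X → ℝ)}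

variable {n : ℕ}

/-- `T* v = (1/n) ∑ᵢ vᵢ k(xᵢ, ·)`. -/
def empAdj (x : Fin n → X) (v : Fin n → ℝ) : H :=
  (n : ℝ)⁻¹ • ∑ i, v i • feature H (x i)

/-- The empirical covariance operator `S = T* T`, where `T g = (g(x₁), …, g(xₙ))`. -/
def empCov (x : Fin n → X) (g : H) : H :=
  empAdj H x (fun i => g (x i))

/-- The current estimate, residual and search direction of the iterative algorithm. -/
structure State where
  g : H
  u : H
  d : H

/-- Empirical KPLS (conjugate gradients for `S g = T* y`), state after `m` iterations. -/
def run (x : Fin n → X) (y : Fin n → ℝ) : ℕ → State H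
  | 0 => ⟨0, empAdj H x y, empAdj H x y⟩
  | m + 1 =>
    let s := run x y m
    let α : ℝ := ‖s.u‖ ^ 2 / inner ℝ s.d (empCov H x s.d)
    let u' : H := s.u - α • empCov H x s.d
    let β : ℝ := ‖u'‖ ^ 2 / ‖s.u‖ ^ 2
    ⟨s.g + α • s.d, u', u' + β • s.d⟩

/-- The matrix of `K = T T*`, that is the kernel Gram matrix with the factor `1/n` coming
from `T*`. -/
def gram (x : Fin n → X) : Matrix (Fin n) (Fin n) ℝ :=
  Matrix.of fun i j => (n : ℝ)⁻¹ * realKernel H (x i) (x j)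

/-- `⟨y, K ^ p y⟩` in `L²` of the empirical distribution of the sample, whose inner product is
`⟨v, w⟩ = (1/n) ∑ᵢ vᵢ wᵢ`. -/
def krylovMoment (x : Fin n → X) (y : Fin n → ℝ) (p : ℕ) : ℝ :=
  (n : ℝ)⁻¹ * (y ⬝ᵥ ((gram H x ^ p).mulVec y))

/-- `M_m`, with entries `⟨y, K ^ (i + j) y⟩` for `1 ≤ i, j ≤ m` (here `i, j` start at `0`). -/
def matM (x : Fin n → X) (y : Fin n → ℝ) (m : ℕ) : Matrix (Fin m) (Fin m) ℝ :=
  Matrix.of fun i j => krylovMoment H x y ((i + 1) + (j + 1))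

/-- `M'_m`, with entries `⟨y, K ^ (i + j - 1) y⟩` for `1 ≤ i, j ≤ m` (here `i, j` start
at `0`). -/
def matM' (x : Fin n → X) (y : Fin n → ℝ) (m : ℕ) : Matrix (Fin m) (Fin m) ℝ :=
  Matrix.of fun i j => krylovMoment H x y ((i + 1) + (j + 1) - 1)

/-- The operator norm of a real square matrix with respect to the Euclidean norm. -/
def opNorm {m : ℕ} (A : Matrix (Fin m) (Fin m) ℝ) : ℝ :=
  ‖Matrix.toEuclideanCLM (n := Fin m) (𝕜 := ℝ) A‖

open scoped Classical in
/-- `‖A⁻¹‖`, with the value `∞` for singular `A`. -/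
def invNorm {m : ℕ} (A : Matrix (Fin m) (Fin m) ℝ) : ℝ≥0∞ :=
  if IsUnit A.det then ENNReal.ofReal (opNorm A⁻¹) else ⊤

/-- The empirical complexity `m (max(‖M'_m‖, 1/m) ‖M_m⁻¹‖)²`. -/
def complexity (x : Fin n → X) (y : Fin n → ℝ) (m : ℕ) : ℝ≥0∞ :=
  (m : ℝ≥0∞) *
    (ENNReal.ofReal (max (opNorm (matM' H x y m)) ((m : ℝ)⁻¹)) * invNorm (matM H x y m)) ^ 2

/-- The first `m ≥ 1` at which the empirical complexity is at least `n ^ ν`. Such an `m` always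
exists, since `M_m` is singular for `m > n`. -/
def firstTime (ν : ℝ) (x : Fin n → X) (y : Fin n → ℝ) : ℕ :=
  sInf {m : ℕ | 1 ≤ m ∧ ENNReal.ofReal ((n : ℝ) ^ ν) ≤ complexity H x y m}

/-- The KPLS estimate with the second stopping rule: the iterate one step before the first time
at which the empirical complexity is at least `n ^ ν`. -/
def estimate (ν : ℝ) (x : Fin n → X) (y : Fin n → ℝ) : H :=
  (run H x y (firstTime H ν x y - 1)).g

end Kernel

/-- The empirically centred vector `yᵢ - (1/n) ∑ⱼ yⱼ`. -/
def center {n : ℕ} (y : Fin n → ℝ) : Fin n → ℝ :=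
  fun i => y i - (n : ℝ)⁻¹ * ∑ j, y j

/-- The regression function `x ↦ E[Y | X = x]` of the joint distribution `P` of `(X, Y)`. -/
def regression {X : Type*} [MeasurableSpace X] (P : Measure (X × ℝ)) [IsFiniteMeasure P]
    (x : X) : ℝ :=
  ∫ y, y ∂(P.condKernel x)

end KPLS

end

/-! Put `b = T* y`. The conjugate gradient iterate `g_m` is the Galerkin solution of `S g = b` in
the Krylov space of the `S ^ i b`, `i < m` (`IsCG.inner_u_eq_zero`), so it minimises the energy `⟪g,
S g⟫ - 2 ⟪b, g⟫` there. If `J` is the inclusion of `H` into `L²(P_X)`, then `‖f - J g‖²` is `‖f‖²`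
plus the energy built from `J* J` and `J* f`. Hence empirical and population energies have to be
compared.

At `g` they differ by at most the errors of `S` and `b` times `1 + ‖g‖²`. Before the stopping time
the complexity bounds `‖g‖²` by `‖b‖² n ^ ν` (`norm_sq_le_of_krylovCost_lt`), while both errors are
almost surely `o(n ^ (-ν))` because `ν < 1 / 2`. So stopping is early enough.

It is also late enough. Universality makes `J J*` injective, so population Krylov spaces approximate
`f`. The least dimension achieving a given accuracy has invertible Hankel matrices, since a singular
one would give `f` exactly in a smaller Krylov space (`exists_approx_of_isUnit`). The empirical
complexities up to that dimension converge to finite limits and eventually lie below `n ^ ν`.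
`tendsto_norm_sub_galerkin` combines both sides.

The rates come from a Hilbert space law of large numbers (`ae_tendsto_rpow_mul_norm_average`):
orthogonal increments and dyadic chaining. It uses measurability of the kernel only, with means
defined weakly. -/

namespace KPLS

/-! ### Conjugate gradients as a Galerkin method in Krylov spaces -/

section ConjugateGradient

variable {H : Type*} [NormedAddCommGroup H] [InnerProductSpace ℝ H]

/-- The Krylov space spanned by `S ^ i b` for `i < m`. -/
def krylov (S : H →L[ℝ] H) (b : H) (m : ℕ) : Submodule ℝ H :=
  Submodule.span ℝ ((fun i : ℕ => (S ^ i) b) '' Set.Iio m)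

lemma pow_apply_mem_krylov (S : H →L[ℝ] H) (b : H) {i m : ℕ} (h : i < m) :
    (S ^ i) b ∈ krylov S b m :=
  Submodule.subset_span ⟨i, h, rfl⟩

lemma krylov_mono (S : H →L[ℝ] H) (b : H) {l m : ℕ} (h : l ≤ m) : krylov S b l ≤ krylov S b m :=
  Submodule.span_mono (Set.image_mono (Set.Iio_subset_Iio h))

lemma map_mem_krylov_succ (S : H →L[ℝ] H) (b : H) {m : ℕ} {v : H} (hv : v ∈ krylov S b m) :
    S v ∈ krylov S b (m + 1) := by
  induction hv using Submodule.span_induction with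
  | mem x hx =>
    obtain ⟨i, hi, rfl⟩ := hx
    have : S ((S ^ i) b) = (S ^ (i + 1)) b := by rw [pow_succ']; rfl
    simp only [this]
    exact pow_apply_mem_krylov S b (Nat.succ_lt_succ hi)
  | zero => simp
  | add x y _ _ hx hy => rw [map_add]; exact add_mem hx hy
  | smul a x _ hx => rw [map_smul]; exact Submodule.smul_mem _ _ hx

lemma exists_coeff_of_mem_krylov (S : H →L[ℝ] H) (b : H) {m : ℕ} {v : H}
    (hv : v ∈ krylov S b m) : ∃ c : Fin m → ℝ, v = ∑ i, c i • (S ^ (i : ℕ)) b := by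
  have h : krylov S b m = Submodule.span ℝ (Set.range fun i : Fin m => (S ^ (i : ℕ)) b) := by
    unfold krylov
    congr 1
    ext x
    constructor
    · rintro ⟨i, hi, rfl⟩
      exact ⟨⟨i, hi⟩, rfl⟩
    · rintro ⟨i, rfl⟩
      exact ⟨i, i.2, rfl⟩
  rw [h, Submodule.mem_span_range_iff_exists_fun] at hv
  obtain ⟨c, hc⟩ := hv
  exact ⟨c, hc.symm⟩

/-- The recursion of the conjugate gradient method for `S g = b`. -/
structure IsCG (S : H →L[ℝ] H) (b : H) (g u d : ℕ → H) : Prop where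
  g_zero : g 0 = 0
  u_zero : u 0 = b
  d_zero : d 0 = b
  g_succ : ∀ m, g (m + 1) = g m + (‖u m‖ ^ 2 / inner ℝ (d m) (S (d m))) • d m
  u_succ : ∀ m, u (m + 1) = u m - (‖u m‖ ^ 2 / inner ℝ (d m) (S (d m))) • S (d m)
  d_succ : ∀ m, d (m + 1) = u (m + 1) + (‖u (m + 1)‖ ^ 2 / ‖u m‖ ^ 2) • d m

namespace IsCG

variable {S : H →L[ℝ] H} {b : H} {g u d : ℕ → H}

lemma u_eq (h : IsCG S b g u d) (m : ℕ) : u m = b - S (g m) := by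
  induction m with
  | zero => simp [h.g_zero, h.u_zero]
  | succ m ih => rw [h.u_succ, h.g_succ, map_add, map_smul, ih]; abel

lemma mem_krylov_succ (h : IsCG S b g u d) (m : ℕ) :
    u m ∈ krylov S b (m + 1) ∧ d m ∈ krylov S b (m + 1) := by
  induction m with
  | zero =>
    have : b ∈ krylov S b (0 + 1) := by simpa using pow_apply_mem_krylov S b (Nat.zero_lt_one)
    exact ⟨h.u_zero ▸ this, h.d_zero ▸ this⟩
  | succ m ih =>
    have hu : u (m + 1) ∈ krylov S b (m + 1 + 1) := by
      rw [h.u_succ]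
      exact sub_mem (krylov_mono S b (Nat.le_succ _) ih.1)
        (Submodule.smul_mem _ _ (map_mem_krylov_succ S b ih.2))
    refine ⟨hu, ?_⟩
    rw [h.d_succ]
    exact add_mem hu (Submodule.smul_mem _ _ (krylov_mono S b (Nat.le_succ _) ih.2))

lemma g_mem_krylov (h : IsCG S b g u d) (m : ℕ) : g m ∈ krylov S b m := by
  induction m with
  | zero => simp [h.g_zero]
  | succ m ih =>
    rw [h.g_succ]
    exact add_mem (krylov_mono S b (Nat.le_succ _) ih)
      (Submodule.smul_mem _ _ (h.mem_krylov_succ m).2)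

lemma u_eq_zero_of_le (h : IsCG S b g u d) {j m : ℕ} (hjm : j ≤ m) (hj : u j = 0) : u m = 0 := by
  induction hjm with
  | refl => exact hj
  | step _ ih => rw [h.u_succ, ih]; simp

/-- The conjugacy relations of the conjugate gradient method. -/
lemma conj (h : IsCG S b g u d) (hS : ∀ v w, inner ℝ (S v) w = inner ℝ v (S w))
    (hker : ∀ v, inner ℝ v (S v) = 0 → inner ℝ b v = 0 ∧ S v = 0) (m : ℕ) :
    (∀ j < m, inner ℝ (u m) (d j) = 0) ∧ (∀ j < m, inner ℝ (d m) (S (d j)) = 0) ∧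
      inner ℝ (u m) (d m) = ‖u m‖ ^ 2 := by
  induction m using Nat.strong_induction_on with
  | _ m ih =>
  rcases m with _ | m
  · refine ⟨by simp, by simp, ?_⟩
    rw [h.u_zero, h.d_zero, real_inner_self_eq_norm_sq]
  -- A zero denominator occurs only once the residual is zero: `hker` kills `⟪b, d j⟫` and `S (d
  -- j)`, hence `⟪u j, d j⟫ = ‖u j‖ ^ 2`. Division by zero is therefore harmless.
  have hden : ∀ j ≤ m, inner ℝ (d j) (S (d j)) = 0 → u j = 0 := by
    intro j hj h0
    have h1 := (ih j (by omega)).2.2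
    rw [h.u_eq, inner_sub_left, hS, (hker _ h0).2, inner_zero_right, (hker _ h0).1,
      ← h.u_eq] at h1
    have : ‖u j‖ ^ 2 = 0 := by linarith
    simpa using this
  have hα : ∀ j ≤ m, ‖u j‖ ^ 2 / inner ℝ (d j) (S (d j)) = 0 → u j = 0 := by
    intro j hj h0
    rcases div_eq_zero_iff.1 h0 with h0 | h0
    · simpa using h0
    · exact hden j hj h0
  obtain ⟨h1, h2, h3⟩ := ih m (by omega)
  have hud : ∀ j < m + 1, inner ℝ (u (m + 1)) (d j) = 0 := by
    intro j hj
    rw [h.u_succ, inner_sub_left, real_inner_smul_left, hS]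
    rcases Nat.lt_succ_iff_lt_or_eq.1 hj with hj | rfl
    · rw [h1 j hj, h2 j hj]; simp
    · rw [h3]
      by_cases h0 : inner ℝ (d j) (S (d j)) = 0
      · simp [hden j le_rfl h0]
      · field_simp; simp
  have huu : ∀ j < m + 1, inner ℝ (u (m + 1)) (u j) = 0 := by
    intro j hj
    rcases j with _ | j
    · rw [h.u_zero, ← h.d_zero]; exact hud 0 hj
    · have : u (j + 1) = d (j + 1) - (‖u (j + 1)‖ ^ 2 / ‖u j‖ ^ 2) • d j := by
        rw [h.d_succ]; abel
      rw [this, inner_sub_right, real_inner_smul_right, hud _ hj, hud j (by omega)]; simp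
  refine ⟨hud, ?_, ?_⟩
  · intro j hj
    by_cases h0 : u j = 0
    · have hm : u (m + 1) = 0 := h.u_eq_zero_of_le hj.le h0
      rw [h.d_succ, hm]; simp
    · have hαj : ‖u j‖ ^ 2 / inner ℝ (d j) (S (d j)) ≠ 0 := fun h' => h0 (hα j (by omega) h')
      -- Since `α_j S d_j = u_j - u_{j+1}`, conjugacy reduces to orthogonality of residuals. For `j
      -- = m` the surviving term is exactly what `β_m` cancels.
      have hSd : (‖u j‖ ^ 2 / inner ℝ (d j) (S (d j))) * inner ℝ (u (m + 1)) (S (d j))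
          = - inner ℝ (u (m + 1)) (u (j + 1)) := by
        rw [← real_inner_smul_right]
        have : (‖u j‖ ^ 2 / inner ℝ (d j) (S (d j))) • S (d j) = u j - u (j + 1) := by
          rw [h.u_succ]; abel
        rw [this, inner_sub_right, huu j hj]; simp
      rw [h.d_succ, inner_add_left, real_inner_smul_left]
      rcases Nat.lt_succ_iff_lt_or_eq.1 hj with hj' | rfl
      · rw [huu (j + 1) (by omega)] at hSd
        rw [h2 j hj']
        simpa [hαj] using hSd
      · rw [real_inner_self_eq_norm_sq] at hSd
        have hd0 : inner ℝ (d j) (S (d j)) ≠ 0 := fun h' => h0 (hden j le_rfl h')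
        have hu0 : ‖u j‖ ^ 2 ≠ 0 := by simpa using h0
        field_simp at hSd ⊢
        linarith
  · rw [h.d_succ, inner_add_right, real_inner_smul_right, hud m (by omega),
      real_inner_self_eq_norm_sq]; simp

/-- The residual after `m` steps is orthogonal to the Krylov space. -/
lemma inner_u_eq_zero (h : IsCG S b g u d) (hS : ∀ v w, inner ℝ (S v) w = inner ℝ v (S w))
    (hker : ∀ v, inner ℝ v (S v) = 0 → inner ℝ b v = 0 ∧ S v = 0) (m : ℕ) {v : H}
    (hv : v ∈ krylov S b m) : inner ℝ (u m) v = 0 := by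
  by_cases h0 : ∃ j < m, u j = 0
  · obtain ⟨j, hj, h0⟩ := h0
    rw [h.u_eq_zero_of_le hj.le h0, inner_zero_left]
  push Not at h0
  -- As no earlier residual vanishes, all step sizes are nonzero and `S d_j` is a combination of
  -- residuals; so the directions span every Krylov vector needed.
  set D : ℕ → Submodule ℝ H := fun l => Submodule.span ℝ (d '' Set.Iio l) with hD
  have dmem : ∀ {j l}, j < l → d j ∈ D l := fun hj => Submodule.subset_span ⟨_, hj, rfl⟩
  have Dmono : ∀ {l l'}, l ≤ l' → D l ≤ D l' := fun hl =>
    Submodule.span_mono (Set.image_mono (Set.Iio_subset_Iio hl))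
  have umem : ∀ j, u j ∈ D (j + 1) := by
    intro j
    rcases j with _ | j
    · rw [h.u_zero, ← h.d_zero]; exact dmem (by omega)
    · have : u (j + 1) = d (j + 1) - (‖u (j + 1)‖ ^ 2 / ‖u j‖ ^ 2) • d j := by
        rw [h.d_succ]; abel
      rw [this]
      exact sub_mem (dmem (by omega)) (Submodule.smul_mem _ _ (dmem (by omega)))
  have Smap : ∀ l ≤ m, ∀ w ∈ D l, S w ∈ D (l + 1) := by
    intro l hl w hw
    induction hw using Submodule.span_induction with
    | mem x hx =>
      obtain ⟨j, hj, rfl⟩ := hx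
      have hj' : j < l := hj
      have hu0 : ‖u j‖ ^ 2 ≠ 0 := by simpa using h0 j (by omega)
      have hd0 : inner ℝ (d j) (S (d j)) ≠ 0 := by
        intro h'
        have h1 := (h.conj hS hker j).2.2
        rw [h.u_eq, inner_sub_left, hS, (hker _ h').2, inner_zero_right, (hker _ h').1,
          ← h.u_eq] at h1
        apply hu0; linarith
      have : S (d j) = (‖u j‖ ^ 2 / inner ℝ (d j) (S (d j)))⁻¹ • (u j - u (j + 1)) := by
        rw [h.u_succ, sub_sub_cancel, smul_smul, inv_mul_cancel₀ (div_ne_zero hu0 hd0), one_smul]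
      rw [this]
      exact Submodule.smul_mem _ _ (sub_mem (Dmono (by omega) (umem j))
        (Dmono (by omega) (umem (j + 1))))
    | zero => simp
    | add x y _ _ hx hy => rw [map_add]; exact add_mem hx hy
    | smul a x _ hx => rw [map_smul]; exact Submodule.smul_mem _ _ hx
  have hpow : ∀ i < m, (S ^ i) b ∈ D (i + 1) := by
    intro i
    induction i with
    | zero => intro _; simpa [h.u_zero] using umem 0
    | succ i ih =>
      intro hi
      have : (S ^ (i + 1)) b = S ((S ^ i) b) := by rw [pow_succ']; rfl
      rw [this]
      exact Smap _ hi.le _ (ih (by omega))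
  have hle : krylov S b m ≤ D m := by
    refine Submodule.span_le.2 ?_
    rintro _ ⟨i, hi, rfl⟩
    exact Dmono (Nat.succ_le_of_lt hi) (hpow i hi)
  replace hv := hle hv
  induction hv using Submodule.span_induction with
  | mem x hx =>
    obtain ⟨j, hj, rfl⟩ := hx
    exact (h.conj hS hker m).1 j hj
  | zero => simp
  | add x y _ _ hx hy =>
    rw [inner_add_right, hx, hy, add_zero]
  | smul a x _ hx =>
    rw [real_inner_smul_right, hx, mul_zero]

end IsCG

end ConjugateGradient

/-! ### Hankel matrices and the norm of Galerkin solutions -/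

section Hankel

variable {H : Type*} [NormedAddCommGroup H] [InnerProductSpace ℝ H]

/-- The Hankel matrix of the moments `⟪b, S ^ (i + j + s) b⟫`. -/
noncomputable def hankel (S : H →L[ℝ] H) (b : H) (s m : ℕ) : Matrix (Fin m) (Fin m) ℝ :=
  Matrix.of fun i j => inner ℝ b ((S ^ ((i : ℕ) + j + s)) b)

/-- The complexity of the Krylov space of dimension `m`. -/
noncomputable def krylovCost (S : H →L[ℝ] H) (b : H) (m : ℕ) : ℝ≥0∞ :=
  (m : ℝ≥0∞) *
    (ENNReal.ofReal (max (opNorm (hankel S b 0 m)) ((m : ℝ)⁻¹)) * invNorm (hankel S b 1 m)) ^ 2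

lemma inner_pow_apply {S : H →L[ℝ] H} (hS : ∀ v w, inner ℝ (S v) w = inner ℝ v (S w)) (i : ℕ)
    (v w : H) : inner ℝ ((S ^ i) v) w = inner ℝ v ((S ^ i) w) := by
  induction i generalizing v w with
  | zero => rfl
  | succ i ih =>
    have h1 : (S ^ (i + 1)) v = S ((S ^ i) v) := by rw [pow_succ']; rfl
    have h2 : (S ^ (i + 1)) w = (S ^ i) (S w) := by rw [pow_succ]; rfl
    rw [h1, h2, hS, ih]

lemma norm_pow_apply_le {S : H →L[ℝ] H} (hS1 : ‖S‖ ≤ 1) (i : ℕ) (v : H) :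
    ‖(S ^ i) v‖ ≤ ‖v‖ := by
  induction i with
  | zero => simp
  | succ i ih =>
    have h1 : (S ^ (i + 1)) v = S ((S ^ i) v) := by rw [pow_succ']; rfl
    rw [h1]
    calc ‖S ((S ^ i) v)‖ ≤ ‖S‖ * ‖(S ^ i) v‖ := S.le_opNorm _
      _ ≤ 1 * ‖v‖ := by gcongr
      _ = ‖v‖ := one_mul _

lemma opNorm_nonneg {m : ℕ} (A : Matrix (Fin m) (Fin m) ℝ) : 0 ≤ opNorm A := norm_nonneg _

lemma norm_mulVec_le {m : ℕ} (A : Matrix (Fin m) (Fin m) ℝ) (x : Fin m → ℝ) :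
    ‖WithLp.toLp 2 (A.mulVec x)‖ ≤ opNorm A * ‖WithLp.toLp 2 x‖ := by
  rw [← Matrix.toEuclideanCLM_toLp]
  exact ContinuousLinearMap.le_opNorm _ _

/-- By symmetry of `S`, a Hankel matrix represents the form `⟪·, S ^ s ·⟫` on Krylov vectors. This
translates matrix equations into Galerkin equations. -/
lemma hankel_mulVec {S : H →L[ℝ] H} (hS : ∀ v w, inner ℝ (S v) w = inner ℝ v (S w)) (b : H)
    {m : ℕ} (s : ℕ) (c : Fin m → ℝ) (i : Fin m) :
    (hankel S b s m).mulVec c i =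
      inner ℝ ((S ^ (i : ℕ)) b) ((S ^ s) (∑ j, c j • (S ^ (j : ℕ)) b)) := by
  simp only [Matrix.mulVec, dotProduct, hankel, Matrix.of_apply, map_sum, map_smul, inner_sum,
    real_inner_smul_right]
  refine Finset.sum_congr rfl fun j _ => ?_
  rw [inner_pow_apply hS, mul_comm]
  have : (S ^ ((i : ℕ) + j + s)) b = (S ^ (i : ℕ)) ((S ^ s) ((S ^ (j : ℕ)) b)) := by
    rw [show (i : ℕ) + j + s = i + (s + j) by ring, pow_add, pow_add]; rfl
  rw [this]

/-- Finite complexity means that the Hankel matrix is invertible, and it bounds the norms. -/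
lemma isUnit_and_le_of_krylovCost_lt {S : H →L[ℝ] H} {b : H} {m : ℕ} (hm : 1 ≤ m) {t : ℝ}
    (hcost : krylovCost S b m < ENNReal.ofReal t) :
    IsUnit (hankel S b 1 m).det ∧
      m * (opNorm (hankel S b 0 m) * opNorm (hankel S b 1 m)⁻¹) ^ 2 ≤ t := by
  have hm0 : (0 : ℝ) < m := by exact_mod_cast hm
  set A := max (opNorm (hankel S b 0 m)) ((m : ℝ)⁻¹) with hA
  -- The floor `1 / m` excludes `0 * ∞ = 0`, so a singular matrix really has infinite cost.
  have hApos : 0 < A := lt_max_of_lt_right (by positivity)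
  have hunit : IsUnit (hankel S b 1 m).det := by
    by_contra h
    rw [krylovCost, invNorm, if_neg h, ← hA, ENNReal.mul_top (by simpa using hApos)] at hcost
    have : (m : ℝ≥0∞) * ⊤ ^ 2 = ⊤ := by
      rw [ENNReal.top_pow (by norm_num), ENNReal.mul_top (by exact_mod_cast hm0.ne')]
    rw [this] at hcost
    exact absurd hcost (by simp)
  refine ⟨hunit, ?_⟩
  have hAB : krylovCost S b m
      = ENNReal.ofReal (m * (A * opNorm (hankel S b 1 m)⁻¹) ^ 2) := by
    rw [krylovCost, invNorm, if_pos hunit, ← hA, ENNReal.ofReal_mul hm0.le, ENNReal.ofReal_natCast,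
      ENNReal.ofReal_pow (mul_nonneg hApos.le (opNorm_nonneg _)), ENNReal.ofReal_mul hApos.le]
  rw [hAB] at hcost
  have hlt := (ENNReal.ofReal_lt_ofReal_iff_of_nonneg (by positivity)).1 hcost
  refine le_trans ?_ hlt.le
  have := opNorm_nonneg (hankel S b 0 m)
  have := opNorm_nonneg (hankel S b 1 m)⁻¹
  gcongr
  exact le_max_left _ _

/-- The norm of the Galerkin solution in a Krylov space is controlled by the complexity. -/
lemma norm_sq_le_of_krylovCost_lt {S : H →L[ℝ] H}
    (hS : ∀ v w, inner ℝ (S v) w = inner ℝ v (S w)) (hS1 : ‖S‖ ≤ 1) {b g : H} {m : ℕ} (hm : 1 ≤ m)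
    (hg : g ∈ krylov S b m) (horth : ∀ v ∈ krylov S b m, inner ℝ (b - S g) v = 0) {t : ℝ}
    (hcost : krylovCost S b m < ENNReal.ofReal t) : ‖g‖ ^ 2 ≤ ‖b‖ ^ 2 * t := by
  obtain ⟨hunit, hle⟩ := isUnit_and_le_of_krylovCost_lt hm hcost
  obtain ⟨c, hc⟩ := exists_coeff_of_mem_krylov S b hg
  -- `e` holds the Krylov coordinates of `b = S ^ 0 b`; the Galerkin equations become `M c = M' e`.
  set e : Fin m → ℝ := Pi.single ⟨0, hm⟩ 1 with he
  have heq : (hankel S b 1 m).mulVec c = (hankel S b 0 m).mulVec e := by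
    ext i
    rw [hankel_mulVec hS, hankel_mulVec hS, ← hc]
    have h1 := horth _ (pow_apply_mem_krylov S b i.2)
    rw [inner_sub_left, sub_eq_zero] at h1
    have h2 : ∑ j, e j • (S ^ (j : ℕ)) b = b := by
      rw [Finset.sum_eq_single ⟨0, hm⟩]
      · simp [he]
      · intro j _ hj; simp [he, hj]
      · simp
    rw [h2, pow_one, real_inner_comm, ← h1, real_inner_comm]
    rfl
  have hceq : c = (hankel S b 1 m)⁻¹.mulVec ((hankel S b 0 m).mulVec e) := by
    rw [← heq, Matrix.mulVec_mulVec, Matrix.nonsing_inv_mul _ hunit, Matrix.one_mulVec]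
  have hcn : ‖WithLp.toLp 2 c‖ ≤ opNorm (hankel S b 0 m) * opNorm (hankel S b 1 m)⁻¹ := by
    have he1 : ‖WithLp.toLp 2 e‖ = 1 := by
      rw [he, PiLp.toLp_single, PiLp.norm_single, norm_one]
    calc ‖WithLp.toLp 2 c‖
        ≤ opNorm (hankel S b 1 m)⁻¹ * ‖WithLp.toLp 2 ((hankel S b 0 m).mulVec e)‖ := by
          conv_lhs => rw [hceq]
          exact norm_mulVec_le _ _
      _ ≤ opNorm (hankel S b 1 m)⁻¹ * (opNorm (hankel S b 0 m) * ‖WithLp.toLp 2 e‖) := by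
          gcongr
          · exact opNorm_nonneg _
          · exact norm_mulVec_le _ _
      _ = _ := by rw [he1]; ring
  have hgn : ‖g‖ ≤ (∑ i, |c i|) * ‖b‖ := by
    rw [hc, Finset.sum_mul]
    refine (norm_sum_le _ _).trans (Finset.sum_le_sum fun i _ => ?_)
    rw [norm_smul, Real.norm_eq_abs]
    gcongr
    exact norm_pow_apply_le hS1 _ _
  -- Cauchy–Schwarz produces the prefactor `m` of the complexity.
  have hcs : (∑ i, |c i|) ^ 2 ≤ m * ‖WithLp.toLp 2 c‖ ^ 2 := by
    have := sq_sum_le_card_mul_sum_sq (s := Finset.univ) (f := fun i => |c i|)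
    simpa [EuclideanSpace.norm_sq_eq] using this
  calc ‖g‖ ^ 2 ≤ ((∑ i, |c i|) * ‖b‖) ^ 2 := by gcongr
    _ = ‖b‖ ^ 2 * (∑ i, |c i|) ^ 2 := by ring
    _ ≤ ‖b‖ ^ 2 * (m * (opNorm (hankel S b 0 m) * opNorm (hankel S b 1 m)⁻¹) ^ 2) := by
        gcongr
        exact hcs.trans (by gcongr)
    _ ≤ ‖b‖ ^ 2 * t := by gcongr

end Hankel

/-! ### The empirical operators and the stopping time -/

section Empirical

variable {X : Type*} (H : Type*) [NormedAddCommGroup H] [InnerProductSpace ℝ H] [CompleteSpace H]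
  [RKHS ℝ H X ℝ] {n : ℕ}

variable {H} in
lemma inner_feature (x : X) (g : H) : inner ℝ (feature H x) g = g x := by
  rw [feature, RKHS.kerFun_inner]; simp

lemma realKernel_eq_inner (x x' : X) :
    realKernel H x x' = inner ℝ (feature H x) (feature H x') := by
  rw [inner_feature, feature, RKHS.kerFun_apply, realKernel]

lemma feature_apply (x x' : X) : feature H x' x = realKernel H x x' := by
  rw [realKernel_eq_inner, inner_feature]

lemma norm_feature_le (hk : ∀ x : X, realKernel H x x ≤ 1) (x : X) : ‖feature H x‖ ≤ 1 := by
  have := hk x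
  rw [realKernel_eq_inner, real_inner_self_eq_norm_sq] at this
  exact (sq_le_one_iff₀ (norm_nonneg _)).1 this

lemma inner_empAdj (x : Fin n → X) (v : Fin n → ℝ) (g : H) :
    inner ℝ (empAdj H x v) g = (n : ℝ)⁻¹ * ∑ i, v i * g (x i) := by
  simp only [empAdj, real_inner_smul_left, sum_inner, inner_feature]

/-- The empirical covariance operator as a continuous linear map. -/
noncomputable def empCovL (x : Fin n → X) : H →L[ℝ] H :=
  (n : ℝ)⁻¹ • ∑ i, InnerProductSpace.rankOne ℝ (feature H (x i)) (feature H (x i))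

lemma empCovL_apply (x : Fin n → X) (g : H) : empCovL H x g = empCov H x g := by
  simp [empCovL, empCov, empAdj, inner_feature]

lemma inner_empCovL (x : Fin n → X) (g h : H) :
    inner ℝ (empCovL H x g) h = (n : ℝ)⁻¹ * ∑ i, g (x i) * h (x i) := by
  rw [empCovL_apply, empCov, inner_empAdj]

lemma empCovL_symm (x : Fin n → X) (g h : H) :
    inner ℝ (empCovL H x g) h = inner ℝ g (empCovL H x h) := by
  rw [real_inner_comm _ g, inner_empCovL, inner_empCovL]
  simp only [mul_comm]

lemma norm_empCovL_le (hk : ∀ x : X, realKernel H x x ≤ 1) (x : Fin n → X) :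
    ‖empCovL H x‖ ≤ 1 := by
  rw [empCovL, norm_smul]
  rcases Nat.eq_zero_or_pos n with rfl | hn
  · simp
  have hn' : (0 : ℝ) < n := by exact_mod_cast hn
  calc ‖(n : ℝ)⁻¹‖ * ‖∑ i, InnerProductSpace.rankOne ℝ (feature H (x i)) (feature H (x i))‖
      ≤ (n : ℝ)⁻¹ * ∑ _i : Fin n, (1 : ℝ) := by
        rw [Real.norm_of_nonneg (by positivity)]
        gcongr
        refine (norm_sum_le _ _).trans (Finset.sum_le_sum fun i _ => ?_)
        rw [InnerProductSpace.norm_rankOne]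
        exact mul_le_one₀ (norm_feature_le H hk _) (norm_nonneg _) (norm_feature_le H hk _)
    _ = 1 := by simp [hn'.ne']

/-- `⟪v, S v⟫` is the empirical mean square of `v`, so `v` vanishes at the sample points, which are
all that `S v` and `⟪T* y, v⟫` see. This supplies `hker`. -/
lemma empCovL_ker (x : Fin n → X) (y : Fin n → ℝ) (v : H) (hv : inner ℝ v (empCovL H x v) = 0) :
    inner ℝ (empAdj H x y) v = 0 ∧ empCovL H x v = 0 := by
  rcases Nat.eq_zero_or_pos n with rfl | hn
  · simp [empAdj, empCovL]
  have hn' : (0 : ℝ) < n := by exact_mod_cast hn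
  rw [real_inner_comm, inner_empCovL] at hv
  have hsum : ∑ i, v (x i) * v (x i) = 0 := by
    rcases mul_eq_zero.1 hv with h | h
    · exact absurd h (by positivity)
    · exact h
  have h0 : ∀ i, v (x i) = 0 := by
    intro i
    have := (Finset.sum_eq_zero_iff_of_nonneg (fun i _ => mul_self_nonneg (v (x i)))).1 hsum i
      (Finset.mem_univ i)
    simpa using this
  constructor
  · rw [inner_empAdj]; simp [h0]
  · rw [empCovL_apply, empCov, empAdj]; simp [h0]

lemma isCG_run (x : Fin n → X) (y : Fin n → ℝ) :
    IsCG (empCovL H x) (empAdj H x y) (fun m => (run H x y m).g) (fun m => (run H x y m).u)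
      (fun m => (run H x y m).d) where
  g_zero := rfl
  u_zero := rfl
  d_zero := rfl
  g_succ m := by simp only [empCovL_apply]; rfl
  u_succ m := by simp only [empCovL_apply]; rfl
  d_succ m := rfl

lemma run_g_mem_krylov (x : Fin n → X) (y : Fin n → ℝ) (m : ℕ) :
    (run H x y m).g ∈ krylov (empCovL H x) (empAdj H x y) m :=
  (isCG_run H x y).g_mem_krylov m

lemma inner_residual_run (x : Fin n → X) (y : Fin n → ℝ) (m : ℕ) {v : H}
    (hv : v ∈ krylov (empCovL H x) (empAdj H x y) m) :
    inner ℝ (empAdj H x y - empCovL H x (run H x y m).g) v = 0 := by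
  rw [← (isCG_run H x y).u_eq m]
  exact (isCG_run H x y).inner_u_eq_zero (empCovL_symm H x) (empCovL_ker H x y) m hv

lemma gram_mulVec (x : Fin n → X) (v : Fin n → ℝ) :
    (gram H x).mulVec v = fun i => empAdj H x v (x i) := by
  ext i
  rw [← inner_feature, real_inner_comm, inner_empAdj]
  simp only [Matrix.mulVec, dotProduct, gram, Matrix.of_apply, Finset.mul_sum, feature_apply]
  refine Finset.sum_congr rfl fun j _ => ?_
  rw [realKernel_eq_inner, realKernel_eq_inner, real_inner_comm]
  ring

lemma empCovL_pow_empAdj (x : Fin n → X) (y : Fin n → ℝ) (p : ℕ) :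
    (empCovL H x ^ p) (empAdj H x y) = empAdj H x ((gram H x ^ p).mulVec y) := by
  induction p with
  | zero => simp
  | succ p ih =>
    have h1 : (empCovL H x ^ (p + 1)) (empAdj H x y)
      = empCovL H x ((empCovL H x ^ p) (empAdj H x y)) := by rw [pow_succ']; rfl
    rw [h1, ih, empCovL_apply, empCov, pow_succ', ← Matrix.mulVec_mulVec, gram_mulVec]

/-- One factor `K = T T*` is spent on moving `T*` to both arguments, and `S T* = T* K` handles the
rest. Hence `M_m` and `M'_m` are Hankel matrices with shifts 1 and 0. -/
lemma krylovMoment_succ (x : Fin n → X) (y : Fin n → ℝ) (p : ℕ) :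
    krylovMoment H x y (p + 1) =
      inner ℝ (empAdj H x y) ((empCovL H x ^ p) (empAdj H x y)) := by
  rw [empCovL_pow_empAdj, inner_empAdj, krylovMoment, pow_succ', ← Matrix.mulVec_mulVec,
    gram_mulVec]
  rfl

lemma matM_eq_hankel (x : Fin n → X) (y : Fin n → ℝ) (m : ℕ) :
    matM H x y m = hankel (empCovL H x) (empAdj H x y) 1 m := by
  ext i j
  simp only [matM, hankel, Matrix.of_apply]
  rw [← krylovMoment_succ]
  congr 1; ring

lemma matM'_eq_hankel (x : Fin n → X) (y : Fin n → ℝ) (m : ℕ) :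
    matM' H x y m = hankel (empCovL H x) (empAdj H x y) 0 m := by
  ext i j
  simp only [matM', hankel, Matrix.of_apply]
  rw [← krylovMoment_succ]
  congr 1; omega

lemma complexity_eq_krylovCost (x : Fin n → X) (y : Fin n → ℝ) (m : ℕ) :
    complexity H x y m = krylovCost (empCovL H x) (empAdj H x y) m := by
  rw [complexity, krylovCost, matM_eq_hankel, matM'_eq_hankel]

/-- More than `n` vectors `K ^ j y` in `ℝ ^ n` are dependent, and `T*` carries the relation over to
the Krylov vectors. -/
lemma det_matM_eq_zero (x : Fin n → X) (y : Fin n → ℝ) {m : ℕ} (hm : n < m) :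
    (matM H x y m).det = 0 := by
  rw [← Matrix.exists_mulVec_eq_zero_iff]
  have hdep : ¬ LinearIndependent ℝ fun j : Fin m => (gram H x ^ (j : ℕ)).mulVec y := by
    intro h
    have := h.fintype_card_le_finrank
    simp at this
    omega
  obtain ⟨c, hc, i, hi⟩ := Fintype.not_linearIndependent_iff.1 hdep
  refine ⟨c, fun h => hi (congrFun h i), ?_⟩
  have hz : ∑ j, c j • (empCovL H x ^ (j : ℕ)) (empAdj H x y) = 0 := by
    have hlin : ∀ v : Fin m → Fin n → ℝ, empAdj H x (∑ j, c j • v j)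
        = ∑ j, c j • empAdj H x (v j) := by
      intro v
      simp only [empAdj, Finset.sum_apply, Pi.smul_apply, smul_eq_mul, Finset.sum_smul,
        Finset.smul_sum, smul_smul]
      rw [Finset.sum_comm]
      refine Finset.sum_congr rfl fun j _ => Finset.sum_congr rfl fun i _ => ?_
      congr 1; ring
    simp only [empCovL_pow_empAdj]
    rw [← hlin, hc, empAdj]
    simp
  rw [matM_eq_hankel]
  ext i
  rw [hankel_mulVec (empCovL_symm H x), hz]
  simp

/-- Before the stopping time the complexity is small, and at the stopping time it is large. -/
lemma firstTime_spec (ν : ℝ) (x : Fin n → X) (y : Fin n → ℝ) :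
    (∀ m, 1 ≤ m → m ≤ firstTime H ν x y - 1 →
      krylovCost (empCovL H x) (empAdj H x y) m < ENNReal.ofReal ((n : ℝ) ^ ν)) ∧
    ENNReal.ofReal ((n : ℝ) ^ ν) ≤
      krylovCost (empCovL H x) (empAdj H x y) (firstTime H ν x y - 1 + 1) := by
  set s := {m : ℕ | 1 ≤ m ∧ ENNReal.ofReal ((n : ℝ) ^ ν) ≤ complexity H x y m} with hs
  -- Nonemptiness rules out the default `sInf ∅ = 0`. The infimum is then at least 1, and
  -- subtracting 1 from it is not truncated.
  have hne : s.Nonempty := by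
    refine ⟨n + 1, by omega, ?_⟩
    have h1 : invNorm (matM H x y (n + 1)) = ⊤ := by
      rw [invNorm, if_neg]
      rw [det_matM_eq_zero H x y (Nat.lt_succ_self n)]
      simp
    have h2 : ENNReal.ofReal (max (opNorm (matM' H x y (n + 1))) (((n + 1 : ℕ) : ℝ)⁻¹)) ≠ 0 := by
      have : 0 < max (opNorm (matM' H x y (n + 1))) (((n + 1 : ℕ) : ℝ)⁻¹) :=
        lt_max_of_lt_right (by positivity)
      exact (ENNReal.ofReal_pos.2 this).ne'
    rw [complexity, h1, ENNReal.mul_top h2, ENNReal.top_pow (by norm_num),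
      ENNReal.mul_top (by exact_mod_cast Nat.succ_ne_zero n)]
    exact le_top
  have hmem : firstTime H ν x y ∈ s := Nat.sInf_mem hne
  constructor
  · intro m hm hm'
    have hnot : m ∉ s := fun h => by
      have : firstTime H ν x y ≤ m := Nat.sInf_le h
      have := hmem.1
      omega
    rw [← complexity_eq_krylovCost]
    by_contra h
    exact hnot ⟨hm, not_lt.1 h⟩
  · rw [Nat.sub_add_cancel hmem.1, ← complexity_eq_krylovCost]
    exact hmem.2

end Empirical

/-! ### Approximation by population Krylov spaces -/

section Population

variable {H F : Type*} [NormedAddCommGroup H] [InnerProductSpace ℝ H] [CompleteSpace H]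
  [NormedAddCommGroup F] [InnerProductSpace ℝ F] [CompleteSpace F]

open ContinuousLinearMap in
lemma adjoint_comp_self_symm (J : H →L[ℝ] F) (v w : H) :
    inner ℝ ((adjoint J ∘L J) v) w = inner ℝ v ((adjoint J ∘L J) w) := by
  simp only [comp_apply, adjoint_inner_left, adjoint_inner_right]

open ContinuousLinearMap in
lemma comp_pow_apply_eq (J : H →L[ℝ] F) (f : F) (i : ℕ) :
    J (((adjoint J ∘L J) ^ i) (adjoint J f)) = ((J ∘L adjoint J) ^ (i + 1)) f := by
  induction i with
  | zero => simp
  | succ i ih =>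
    have h1 : ((adjoint J ∘L J) ^ (i + 1)) (adjoint J f)
      = adjoint J (J (((adjoint J ∘L J) ^ i) (adjoint J f))) := by rw [pow_succ']; rfl
    rw [h1, ih, pow_succ' _ (i + 1)]; rfl

open ContinuousLinearMap in
-- `⟪J J* w, w⟫ = ‖J* w‖²`, and the kernel of `J*` is orthogonal to the dense range of `J`.
lemma injective_comp_adjoint {J : H →L[ℝ] F} (hJ : DenseRange J) {w : F}
    (hw : (J ∘L adjoint J) w = 0) : w = 0 := by
  have h1 : adjoint J w = 0 := by
    rw [← inner_self_eq_zero (𝕜 := ℝ), adjoint_inner_left]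
    have : J (adjoint J w) = 0 := hw
    rw [this, inner_zero_right]
  refine hJ.eq_zero_of_inner_right ℝ fun v => ?_
  rw [← adjoint_inner_right, h1, inner_zero_right]

open ContinuousLinearMap in
/-- Every vector is approximated by the Krylov vectors of an injective positive operator. -/
lemma mem_closure_krylov {J : H →L[ℝ] F} (hJ : DenseRange J) (f : F) :
    f ∈ (Submodule.span ℝ (Set.range fun i : ℕ =>
      ((J ∘L adjoint J) ^ (i + 1)) f)).topologicalClosure := by
  set K := J ∘L adjoint J with hK
  set V := (Submodule.span ℝ (Set.range fun i : ℕ => (K ^ (i + 1)) f)).topologicalClosure with hV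
  have hVc : IsClosed (V : Set F) := Submodule.isClosed_topologicalClosure _
  have : CompleteSpace V := hVc.completeSpace_coe
  have hKs : ∀ v w, inner ℝ (K v) w = inner ℝ v (K w) := by
    intro v w
    simp only [hK, comp_apply]
    rw [← adjoint_inner_right, adjoint_inner_left]
  have hspan : ∀ v ∈ Submodule.span ℝ (Set.range fun i : ℕ => (K ^ (i + 1)) f), K v ∈ V := by
    intro v hv
    refine Submodule.le_topologicalClosure _ ?_
    induction hv using Submodule.span_induction with
    | mem x hx =>
      obtain ⟨i, rfl⟩ := hx
      refine Submodule.subset_span ⟨i + 1, ?_⟩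
      simp only [pow_succ' K (i + 1)]; rfl
    | zero => simp
    | add x y _ _ hx hy => rw [map_add]; exact add_mem hx hy
    | smul a x _ hx => rw [map_smul]; exact Submodule.smul_mem _ _ hx
  have hKV : ∀ v ∈ V, K v ∈ V := by
    intro v hv
    have hsub : (V : Set F) ⊆ K ⁻¹' V :=
      closure_minimal hspan (hVc.preimage K.continuous)
    exact hsub hv
  -- The component `w` of `f` orthogonal to `V` has `K w = K f - K v` in `V`, and in `Vᗮ` by
  -- symmetry of `K`. So `K w = 0`, and injectivity gives `w = 0`.
  obtain ⟨v, hv, w, hw, hvw⟩ := V.exists_add_mem_mem_orthogonal f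
  have hKf : K f ∈ V :=
    Submodule.le_topologicalClosure _ (Submodule.subset_span ⟨0, by simp⟩)
  have hKw : K w ∈ V := by
    have : K w = K f - K v := by rw [hvw, map_add]; abel
    rw [this]
    exact sub_mem hKf (hKV v hv)
  have hKw' : K w ∈ Vᗮ := by
    rw [Submodule.mem_orthogonal]
    intro u hu
    rw [← hKs]
    exact Submodule.inner_right_of_mem_orthogonal (hKV u hu) hw
  have h0 : K w = 0 := by
    rw [← inner_self_eq_zero (𝕜 := ℝ)]
    exact Submodule.inner_right_of_mem_orthogonal hKw hKw'
  have hw0 : w = 0 := injective_comp_adjoint hJ h0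
  rw [hvw, hw0, add_zero]
  exact hv

open ContinuousLinearMap in
lemma exists_mem_krylov_norm_sub_lt {J : H →L[ℝ] F} (hJ : DenseRange J) (f : F) {ε : ℝ}
    (hε : 0 < ε) :
    ∃ m, ∃ h ∈ krylov (adjoint J ∘L J) (adjoint J f) m, ‖f - J h‖ < ε := by
  have hmem := mem_closure_krylov hJ f
  rw [← SetLike.mem_coe, Submodule.topologicalClosure_coe, Metric.mem_closure_iff] at hmem
  obtain ⟨v, hv, hfv⟩ := hmem ε hε
  suffices ∃ m, ∃ h ∈ krylov (adjoint J ∘L J) (adjoint J f) m, J h = v by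
    obtain ⟨m, h, hh, rfl⟩ := this
    exact ⟨m, h, hh, by rwa [← dist_eq_norm]⟩
  clear hfv
  induction hv using Submodule.span_induction with
  | mem x hx =>
    obtain ⟨i, rfl⟩ := hx
    exact ⟨i + 1, _, pow_apply_mem_krylov _ _ (Nat.lt_succ_self i), comp_pow_apply_eq J f i⟩
  | zero => exact ⟨0, 0, zero_mem _, map_zero _⟩
  | add x y _ _ hx hy =>
    obtain ⟨m, h, hm, rfl⟩ := hx
    obtain ⟨m', h', hm', rfl⟩ := hy
    exact ⟨max m m', h + h', add_mem (krylov_mono _ _ (le_max_left _ _) hm)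
      (krylov_mono _ _ (le_max_right _ _) hm'), map_add _ _ _⟩
  | smul a x _ hx =>
    obtain ⟨m, h, hm, rfl⟩ := hx
    exact ⟨m, a • h, Submodule.smul_mem _ _ hm, map_smul _ _ _⟩

open ContinuousLinearMap in
/-- If the Hankel matrix is singular, then `f` is the image of an element of the previous Krylov
space. -/
lemma exists_mem_krylov_eq_of_not_isUnit {J : H →L[ℝ] F} (hJ : DenseRange J) (f : F) {m : ℕ}
    (hdet : ¬ IsUnit (hankel (adjoint J ∘L J) (adjoint J f) 1 (m + 1)).det) :
    ∃ h ∈ krylov (adjoint J ∘L J) (adjoint J f) m, J h = f := by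
  set S := adjoint J ∘L J with hS
  set K := J ∘L adjoint J with hK
  set b := adjoint J f with hb
  rw [isUnit_iff_ne_zero, not_not, ← Matrix.exists_mulVec_eq_zero_iff] at hdet
  obtain ⟨c, hc0, hc⟩ := hdet
  set w := ∑ j, c j • (S ^ (j : ℕ)) b with hw
  -- A null vector of the Hankel matrix gives `0 = ⟪w, S w⟫ = ‖J w‖²`.
  have hJw : J w = 0 := by
    have h1 : inner ℝ w (S w) = 0 := by
      conv_lhs => rw [hw, sum_inner]
      refine Finset.sum_eq_zero fun i _ => ?_
      have := congrFun hc i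
      rw [hankel_mulVec (adjoint_comp_self_symm J), pow_one, ← hS, ← hw] at this
      rw [real_inner_smul_left, this]; simp
    rw [hS, comp_apply, adjoint_inner_right] at h1
    exact inner_self_eq_zero.1 h1
  have hsum : ∑ j : Fin (m + 1), c j • (K ^ ((j : ℕ) + 1)) f = 0 := by
    rw [← hJw, hw, map_sum]
    refine Finset.sum_congr rfl fun j _ => ?_
    rw [map_smul, comp_pow_apply_eq]
  have hKinj : ∀ (i : ℕ) (v : F), (K ^ i) v = 0 → v = 0 := by
    intro i
    induction i with
    | zero => intro v hv; simpa using hv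
    | succ i ih =>
      intro v hv
      refine ih v (injective_comp_adjoint hJ ?_)
      rw [← hv, pow_succ']; rfl
  -- the first nonzero coefficient
  have hex : ∃ j : Fin (m + 1), c j ≠ 0 := by
    by_contra h
    push Not at h
    exact hc0 (funext h)
  obtain ⟨j0, hj0, hmin⟩ : ∃ j0 : Fin (m + 1), c j0 ≠ 0 ∧ ∀ j < j0, c j = 0 := by
    have hne : (Finset.univ.filter fun j => c j ≠ 0).Nonempty := by
      obtain ⟨j, hj⟩ := hex
      exact ⟨j, by simpa using hj⟩
    refine ⟨Finset.min' _ hne, by simpa using Finset.min'_mem _ hne, fun j hj => ?_⟩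
    by_contra h
    exact absurd (Finset.min'_le _ j (by simpa using h)) (not_le.2 hj)
  -- Cancelling the injective `K ^ (j0 + 1)` leaves `c_{j0} f` plus positive powers of `K` applied
  -- to `f`, which is solved for `f`. The preimages use `S ^ (j - j0 - 1) b`, with exponents below
  -- `m`.
  have hpow : (K ^ ((j0 : ℕ) + 1)) (∑ j ∈ Finset.univ.filter (fun j => j0 ≤ j),
      c j • (K ^ ((j : ℕ) - j0)) f) = 0 := by
    rw [← hsum, map_sum]
    rw [Finset.sum_filter]
    refine Finset.sum_congr rfl fun j _ => ?_
    split_ifs with h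
    · rw [map_smul]
      congr 1
      have h' : (j0 : ℕ) ≤ j := h
      have : (K ^ ((j : ℕ) + 1)) = K ^ ((j0 : ℕ) + 1) * K ^ ((j : ℕ) - j0) := by
        rw [← pow_add]; congr 1; omega
      rw [this]; rfl
    · rw [hmin j (not_le.1 h), zero_smul]
  have hz := hKinj _ _ hpow
  refine ⟨-(c j0)⁻¹ • ∑ j ∈ Finset.univ.filter (fun j => j0 < j),
    c j • (S ^ ((j : ℕ) - j0 - 1)) b, ?_, ?_⟩
  · refine Submodule.smul_mem _ _ (Submodule.sum_mem _ fun j hj => Submodule.smul_mem _ _ ?_)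
    have hj' : (j0 : ℕ) < j := (Finset.mem_filter.1 hj).2
    exact pow_apply_mem_krylov _ _ (by omega)
  · have hsplit : Finset.univ.filter (fun j => j0 ≤ j)
        = insert j0 (Finset.univ.filter (fun j => j0 < j)) := by
      ext j
      simp [le_iff_eq_or_lt, eq_comm]
    rw [hsplit, Finset.sum_insert (by simp), Nat.sub_self, pow_zero] at hz
    have h2 : J (∑ j ∈ Finset.univ.filter (fun j => j0 < j),
        c j • (S ^ ((j : ℕ) - j0 - 1)) b) = ∑ j ∈ Finset.univ.filter (fun j => j0 < j),
        c j • (K ^ ((j : ℕ) - j0)) f := by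
      rw [map_sum]
      refine Finset.sum_congr rfl fun j hj => ?_
      have hj' : (j0 : ℕ) < j := (Finset.mem_filter.1 hj).2
      rw [map_smul, comp_pow_apply_eq]
      congr 3; omega
    rw [map_smul, h2, eq_neg_of_add_eq_zero_right hz]
    simp [hj0]

open ContinuousLinearMap in
/-- Approximation in a Krylov space whose Hankel matrices are all invertible. -/
lemma exists_approx_of_isUnit {J : H →L[ℝ] F} (hJ : DenseRange J) (f : F) {ε : ℝ} (hε : 0 < ε) :
    ∃ m, (∀ j, 1 ≤ j → j ≤ m → IsUnit (hankel (adjoint J ∘L J) (adjoint J f) 1 j).det) ∧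
      ∃ h ∈ krylov (adjoint J ∘L J) (adjoint J f) m, ‖f - J h‖ < ε := by
  classical
  have hex := exists_mem_krylov_norm_sub_lt hJ f hε
  -- Minimality of the dimension forces invertibility: a singular matrix would make a smaller Krylov
  -- space reach `f` exactly.
  refine ⟨Nat.find hex, fun j hj hjm => ?_, Nat.find_spec hex⟩
  by_contra hdet
  obtain ⟨j, rfl⟩ := Nat.exists_eq_succ_of_ne_zero (by omega : j ≠ 0)
  obtain ⟨h, hh, hJh⟩ := exists_mem_krylov_eq_of_not_isUnit hJ f hdet
  exact Nat.find_min hex (Nat.lt_of_succ_le hjm) ⟨h, hh, by rw [hJh]; simpa using hε⟩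

end Population

/-! ### Deterministic consistency of stopped Galerkin solutions -/

section Deterministic

variable {H F : Type*} [NormedAddCommGroup H] [InnerProductSpace ℝ H]
  [NormedAddCommGroup F] [InnerProductSpace ℝ F]

lemma continuous_opNorm {m : ℕ} :
    Continuous (opNorm : Matrix (Fin m) (Fin m) ℝ → ℝ) := by
  have : Continuous (Matrix.toEuclideanCLM (n := Fin m) (𝕜 := ℝ)) :=
    LinearMap.continuous_of_finiteDimensional
      (Matrix.toEuclideanCLM (n := Fin m) (𝕜 := ℝ)).toAlgEquiv.toLinearMap
  exact continuous_norm.comp this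

lemma tendsto_clm_apply {ι : Type*} {l : Filter ι} {Sn : ι → H →L[ℝ] H} {vn : ι → H}
    {S : H →L[ℝ] H} {v : H} (hS : Tendsto Sn l (𝓝 S)) (hv : Tendsto vn l (𝓝 v)) :
    Tendsto (fun n => Sn n (vn n)) l (𝓝 (S v)) :=
  (isBoundedBilinearMap_apply.continuous.tendsto (S, v)).comp (hS.prodMk_nhds hv)

lemma tendsto_hankel {ι : Type*} {l : Filter ι} {Sn : ι → H →L[ℝ] H} {bn : ι → H} {S : H →L[ℝ] H}
    {b : H} (hS : Tendsto Sn l (𝓝 S)) (hb : Tendsto bn l (𝓝 b)) (s m : ℕ) :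
    Tendsto (fun n => hankel (Sn n) (bn n) s m) l (𝓝 (hankel S b s m)) := by
  refine tendsto_pi_nhds.2 fun i => tendsto_pi_nhds.2 fun j => ?_
  exact hb.inner (tendsto_clm_apply (hS.pow _) hb)

/-- The complexities converge to a finite limit when the limiting Hankel matrix is invertible. -/
lemma eventually_krylovCost_lt {ι : Type*} {l : Filter ι} {Sn : ι → H →L[ℝ] H} {bn : ι → H}
    {S : H →L[ℝ] H} {b : H} (hS : Tendsto Sn l (𝓝 S)) (hb : Tendsto bn l (𝓝 b)) {m : ℕ}
    (hdet : IsUnit (hankel S b 1 m).det) {t : ι → ℝ} (ht : Tendsto t l atTop) :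
    ∀ᶠ n in l, krylovCost (Sn n) (bn n) m < ENNReal.ofReal (t n) := by
  have hM := tendsto_hankel hS hb 1 m
  have hM' := tendsto_hankel hS hb 0 m
  have hd : Tendsto (fun n => (hankel (Sn n) (bn n) 1 m).det) l (𝓝 (hankel S b 1 m).det) :=
    ((continuous_id.matrix_det).tendsto _).comp hM
  have hinv : Tendsto (fun n => (hankel (Sn n) (bn n) 1 m)⁻¹) l (𝓝 (hankel S b 1 m)⁻¹) := by
    simp only [Matrix.inv_def, Ring.inverse_eq_inv']
    exact (hd.inv₀ hdet.ne_zero).smul (((continuous_id.matrix_adjugate).tendsto _).comp hM)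
  have hlim : Tendsto (fun n => (m : ℝ) * (max (opNorm (hankel (Sn n) (bn n) 0 m)) ((m : ℝ)⁻¹) *
      opNorm (hankel (Sn n) (bn n) 1 m)⁻¹) ^ 2) l (𝓝 ((m : ℝ) *
        (max (opNorm (hankel S b 0 m)) ((m : ℝ)⁻¹) * opNorm (hankel S b 1 m)⁻¹) ^ 2)) :=
    (((((continuous_opNorm.tendsto _).comp hM').max tendsto_const_nhds).mul
      ((continuous_opNorm.tendsto _).comp hinv)).pow 2).const_mul _
  filter_upwards [hd.eventually_ne hdet.ne_zero, hlim.eventually_lt_const (lt_add_one _),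
    ht.eventually_ge_atTop ((m : ℝ) *
        (max (opNorm (hankel S b 0 m)) ((m : ℝ)⁻¹) * opNorm (hankel S b 1 m)⁻¹) ^ 2 + 1)]
    with n h1 h2 h3
  have hA : 0 ≤ max (opNorm (hankel (Sn n) (bn n) 0 m)) ((m : ℝ)⁻¹) :=
    le_max_of_le_left (opNorm_nonneg _)
  rw [krylovCost, invNorm, if_pos (isUnit_iff_ne_zero.2 h1), ← ENNReal.ofReal_mul hA,
    ← ENNReal.ofReal_pow (mul_nonneg hA (opNorm_nonneg _)), ← ENNReal.ofReal_natCast,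
    ← ENNReal.ofReal_mul (Nat.cast_nonneg _)]
  exact (ENNReal.ofReal_lt_ofReal_iff_of_nonneg (by positivity)).2 (h2.trans_le h3)

/-- The quadratic functional whose minimiser solves `S g = b`. -/
noncomputable def energy (S : H →L[ℝ] H) (b g : H) : ℝ := inner ℝ g (S g) - 2 * inner ℝ b g

open ContinuousLinearMap in
lemma norm_sub_sq_eq_energy [CompleteSpace H] [CompleteSpace F] (J : H →L[ℝ] F) (f : F) (g : H) :
    ‖f - J g‖ ^ 2 = ‖f‖ ^ 2 + energy (adjoint J ∘L J) (adjoint J f) g := by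
  rw [norm_sub_sq_real, energy, comp_apply, adjoint_inner_right, adjoint_inner_left,
    real_inner_self_eq_norm_sq]
  ring

/-- The energy at `h` exceeds that at `g` by `⟪h - g, S (h - g)⟫ - 2 ⟪b - S g, h - g⟫`. -/
lemma energy_le_of_galerkin {S : H →L[ℝ] H} (hS : ∀ v w, inner ℝ (S v) w = inner ℝ v (S w))
    (hpos : ∀ v, 0 ≤ inner ℝ v (S v)) {b g h : H} (horth : inner ℝ (b - S g) (h - g) = 0) :
    energy S b g ≤ energy S b h := by
  have h1 := hpos (h - g)
  have h2 := hS h g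
  have h3 := real_inner_comm g (S h)
  simp only [energy, map_sub, inner_sub_left, inner_sub_right] at *
  have h4 := hS g g
  have h5 := hS g h
  have h6 := real_inner_comm h (S g)
  linarith

/-- The linear term is absorbed through `2 ‖g‖ ≤ 1 + ‖g‖ ^ 2`, because the stopping rule controls
`‖g‖ ^ 2`. -/
lemma abs_energy_sub_le (S S' : H →L[ℝ] H) (b b' g : H) :
    |energy S b g - energy S' b' g| ≤ ‖S - S'‖ * ‖g‖ ^ 2 + ‖b - b'‖ * (1 + ‖g‖ ^ 2) := by
  have h1 : energy S b g - energy S' b' g = inner ℝ g ((S - S') g) - 2 * inner ℝ (b - b') g := by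
    simp only [energy, sub_apply, inner_sub_left, inner_sub_right]
    ring
  have h2 : |inner ℝ g ((S - S') g)| ≤ ‖S - S'‖ * ‖g‖ ^ 2 := by
    calc |inner ℝ g ((S - S') g)| ≤ ‖g‖ * ‖(S - S') g‖ := abs_real_inner_le_norm _ _
      _ ≤ ‖g‖ * (‖S - S'‖ * ‖g‖) := by gcongr; exact ContinuousLinearMap.le_opNorm _ _
      _ = _ := by ring
  have h3 : |inner ℝ (b - b') g| ≤ ‖b - b'‖ * ‖g‖ := abs_real_inner_le_norm _ _
  have h4 : ‖b - b'‖ * (2 * ‖g‖) ≤ ‖b - b'‖ * (1 + ‖g‖ ^ 2) := by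
    gcongr
    nlinarith [sq_nonneg (‖g‖ - 1)]
  rw [h1]
  calc _ ≤ |inner ℝ g ((S - S') g)| + |2 * inner ℝ (b - b') g| := abs_sub _ _
    _ = |inner ℝ g ((S - S') g)| + 2 * |inner ℝ (b - b') g| := by rw [abs_mul]; norm_num
    _ ≤ _ := by linarith

lemma tendsto_energy {ι : Type*} {l : Filter ι} {Sn : ι → H →L[ℝ] H} {bn hn : ι → H}
    {S : H →L[ℝ] H} {b h : H} (hS : Tendsto Sn l (𝓝 S)) (hb : Tendsto bn l (𝓝 b))
    (hh : Tendsto hn l (𝓝 h)) :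
    Tendsto (fun n => energy (Sn n) (bn n) (hn n)) l (𝓝 (energy S b h)) :=
  (hh.inner (tendsto_clm_apply hS hh)).sub ((hb.inner hh).const_mul 2)

lemma tendsto_zero_of_rpow_mul {ν : ℝ} (hν : 0 < ν) {a : ℕ → ℝ} (ha : ∀ n, 0 ≤ a n)
    (h : Tendsto (fun n : ℕ => (n : ℝ) ^ ν * a n) atTop (𝓝 0)) : Tendsto a atTop (𝓝 0) := by
  refine squeeze_zero' (Eventually.of_forall ha) ?_ h
  filter_upwards [eventually_ge_atTop 1] with n hn
  exact le_mul_of_one_le_left (ha n) (Real.one_le_rpow (by exact_mod_cast hn) hν.le)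

open ContinuousLinearMap in
/-- Consistency of Galerkin solutions in Krylov spaces of noisy operators, when the dimension of
the Krylov space is chosen by a complexity criterion. -/
theorem tendsto_norm_sub_galerkin [CompleteSpace H] [CompleteSpace F]
    {J : H →L[ℝ] F} (hJ : DenseRange J) (f : F)
    {Sn : ℕ → H →L[ℝ] H} {bn gn : ℕ → H} {kn : ℕ → ℕ} {ν : ℝ} (hν : 0 < ν)
    (hsymm : ∀ n v w, inner ℝ (Sn n v) w = inner ℝ v (Sn n w))
    (hpos : ∀ n v, 0 ≤ inner ℝ v (Sn n v)) (hnorm : ∀ n, ‖Sn n‖ ≤ 1)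
    (hS : Tendsto (fun n : ℕ => (n : ℝ) ^ ν * ‖Sn n - adjoint J ∘L J‖) atTop (𝓝 0))
    (hb : Tendsto (fun n : ℕ => (n : ℝ) ^ ν * ‖bn n - adjoint J f‖) atTop (𝓝 0))
    (hg : ∀ n, gn n ∈ krylov (Sn n) (bn n) (kn n))
    (horth : ∀ n, ∀ v ∈ krylov (Sn n) (bn n) (kn n), inner ℝ (bn n - Sn n (gn n)) v = 0)
    (hlt : ∀ n m : ℕ, 1 ≤ m → m ≤ kn n → krylovCost (Sn n) (bn n) m < ENNReal.ofReal ((n : ℝ) ^ ν))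
    (hge : ∀ n : ℕ, ENNReal.ofReal ((n : ℝ) ^ ν) ≤ krylovCost (Sn n) (bn n) (kn n + 1)) :
    Tendsto (fun n => ‖f - J (gn n)‖) atTop (𝓝 0) := by
  set S := adjoint J ∘L J with hSdef
  set b := adjoint J f with hbdef
  have hS0 := tendsto_zero_of_rpow_mul hν (fun n => norm_nonneg _) hS
  have hb0 := tendsto_zero_of_rpow_mul hν (fun n => norm_nonneg _) hb
  have hSt : Tendsto Sn atTop (𝓝 S) := tendsto_iff_norm_sub_tendsto_zero.2 hS0
  have hbt : Tendsto bn atTop (𝓝 b) := tendsto_iff_norm_sub_tendsto_zero.2 hb0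
  have htop : Tendsto (fun n : ℕ => (n : ℝ) ^ ν) atTop atTop :=
    (tendsto_rpow_atTop hν).comp tendsto_natCast_atTop_atTop
  have hgn : ∀ n, ‖gn n‖ ^ 2 ≤ ‖bn n‖ ^ 2 * (n : ℝ) ^ ν := by
    intro n
    rcases Nat.eq_zero_or_pos (kn n) with h0 | h0
    · have h1 := hg n
      rw [h0] at h1
      have h2 : gn n = 0 := by simpa [krylov] using h1
      rw [h2]
      simp only [norm_zero]
      have : (0 : ℝ) ≤ (n : ℝ) ^ ν := Real.rpow_nonneg (Nat.cast_nonneg _) _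
      nlinarith [mul_nonneg (sq_nonneg ‖bn n‖) this]
    · exact norm_sq_le_of_krylovCost_lt (hsymm n) (hnorm n) h0 (hg n) (horth n)
        (hlt n _ h0 le_rfl)
  -- The energy error at `gn n`, with `‖gn n‖ ^ 2` replaced by its bound; the assumed rates absorb
  -- the factor `n ^ ν`.
  set δ : ℕ → ℝ := fun n => ‖Sn n - S‖ * (‖bn n‖ ^ 2 * (n : ℝ) ^ ν) +
    ‖bn n - b‖ * (1 + ‖bn n‖ ^ 2 * (n : ℝ) ^ ν) with hδ
  have hδ0 : Tendsto δ atTop (𝓝 0) := by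
    have h1 := (hS.mul (hbt.norm.pow 2)).add (hb0.add (hb.mul (hbt.norm.pow 2)))
    simp only [zero_mul, add_zero] at h1
    refine h1.congr fun n => ?_
    simp only [hδ]; ring
  have henergy : ∀ n, energy S b (gn n) ≤ energy (Sn n) (bn n) (gn n) + δ n := by
    intro n
    have h1 := abs_energy_sub_le (Sn n) S (bn n) b (gn n)
    have h2 : ‖Sn n - S‖ * ‖gn n‖ ^ 2 + ‖bn n - b‖ * (1 + ‖gn n‖ ^ 2) ≤ δ n := by
      simp only [hδ]
      gcongr <;> exact hgn n
    have h3 := (abs_le.1 (h1.trans h2)).1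
    linarith
  have key : ∀ ε > 0, ∀ᶠ n in atTop, ‖f - J (gn n)‖ < ε := by
    intro ε hε
    obtain ⟨m, hdet, h, hh, hfh⟩ := exists_approx_of_isUnit hJ f hε
    obtain ⟨c, hc⟩ := exists_coeff_of_mem_krylov _ _ hh
    -- Costs in dimensions up to `m` eventually stay below `n ^ ν`, but the cost in dimension `kn n
    -- + 1` does not.
    have hkn : ∀ᶠ n in atTop, m ≤ kn n := by
      have h1 : ∀ᶠ n : ℕ in atTop, ∀ j ∈ Finset.Icc 1 m,
          krylovCost (Sn n) (bn n) j < ENNReal.ofReal ((n : ℝ) ^ ν) := by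
        refine (Finset.eventually_all _).2 fun j hj => ?_
        rw [Finset.mem_Icc] at hj
        exact eventually_krylovCost_lt hSt hbt (hdet j hj.1 hj.2) htop
      filter_upwards [h1] with n hn
      by_contra hlt'
      exact absurd (hge n) (not_le.2 (hn _ (Finset.mem_Icc.2 ⟨by omega, by omega⟩)))
    -- The competitor carries the population coefficients over to the empirical Krylov vectors.
    set hn : ℕ → H := fun n => ∑ i, c i • (Sn n ^ (i : ℕ)) (bn n) with hhn
    have hnt : Tendsto hn atTop (𝓝 h) := by
      rw [hc]
      exact tendsto_finsetSum _ fun i _ => (tendsto_clm_apply (hSt.pow _) hbt).const_smul _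
    have hlim : Tendsto (fun n => ‖f‖ ^ 2 + (energy (Sn n) (bn n) (hn n) + δ n)) atTop
        (𝓝 (‖f - J h‖ ^ 2)) := by
      rw [norm_sub_sq_eq_energy]
      simpa using ((tendsto_energy hSt hbt hnt).add hδ0).const_add (‖f‖ ^ 2)
    have hlt2 : ‖f - J h‖ ^ 2 < ε ^ 2 := by gcongr
    filter_upwards [hkn, hlim.eventually_lt_const hlt2] with n h1 h2
    have hmem : hn n ∈ krylov (Sn n) (bn n) (kn n) :=
      Submodule.sum_mem _ fun i _ => Submodule.smul_mem _ _
        (pow_apply_mem_krylov _ _ (lt_of_lt_of_le i.2 h1))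
    have h3 : energy (Sn n) (bn n) (gn n) ≤ energy (Sn n) (bn n) (hn n) :=
      energy_le_of_galerkin (hsymm n) (hpos n) (horth n _ (sub_mem hmem (hg n)))
    have h4 : ‖f - J (gn n)‖ ^ 2 < ε ^ 2 := by
      rw [norm_sub_sq_eq_energy]
      have := henergy n
      linarith
    exact lt_of_pow_lt_pow_left₀ 2 hε.le h4
  rw [Metric.tendsto_nhds]
  intro ε hε
  simpa using key ε hε

end Deterministic

/-! ### Almost sure growth by dyadic chaining -/

section Chaining

variable {G : Type*} [NormedAddCommGroup G]

/-- A dyadic bound for the squared oscillation of a sequence over `[a, a + 2 ^ k]`. -/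
noncomputable def dyadicBound (ρ κ : ℝ) (s : ℕ → G) : ℕ → ℕ → ℝ
  | 0, a => ‖s (a + 1) - s a‖ ^ 2
  | k + 1, a => ρ * (dyadicBound ρ κ s k a + dyadicBound ρ κ s k (a + 2 ^ k)) +
      κ * ‖s (a + 2 ^ k) - s a‖ ^ 2

lemma dyadicBound_nonneg {ρ κ : ℝ} (hρ : 0 ≤ ρ) (hκ : 0 ≤ κ) (s : ℕ → G) (k a : ℕ) :
    0 ≤ dyadicBound ρ κ s k a := by
  induction k generalizing a with
  | zero => simp only [dyadicBound]; positivity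
  | succ k ih =>
    have h1 := ih a
    have h2 := ih (a + 2 ^ k)
    simp only [dyadicBound]
    positivity

/-- An index in the right half is reached through the midpoint, using `(x + y)² ≤ ρ x² + ρ / (ρ - 1)
y²`. Keeping both halves makes one bound serve all `j`. With `ρ` near 1, the mean of the bound grows
little faster than `2 ^ k`. -/
lemma norm_sub_sq_le_dyadicBound {ρ κ : ℝ} (hρ : 1 < ρ) (hκ : κ = ρ / (ρ - 1)) (s : ℕ → G)
    (k a j : ℕ) (hj : j ≤ 2 ^ k) : ‖s (a + j) - s a‖ ^ 2 ≤ dyadicBound ρ κ s k a := by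
  have hρ1 : 0 < ρ - 1 := by linarith
  have hκ0 : 0 ≤ κ := by rw [hκ]; positivity
  induction k generalizing a j with
  | zero =>
    have : j = 0 ∨ j = 1 := by simp at hj; omega
    rcases this with rfl | rfl
    · simpa using dyadicBound_nonneg (ρ := ρ) (by linarith) hκ0 s 0 a
    · rfl
  | succ k ih =>
    have h1 := dyadicBound_nonneg (ρ := ρ) (by linarith) hκ0 s k a
    have h2 := dyadicBound_nonneg (ρ := ρ) (by linarith) hκ0 s k (a + 2 ^ k)
    simp only [dyadicBound]
    rcases le_or_gt j (2 ^ k) with h | h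
    · have := ih a j h
      have h3 : 0 ≤ κ * ‖s (a + 2 ^ k) - s a‖ ^ 2 := by positivity
      nlinarith
    · obtain ⟨i, rfl⟩ := Nat.exists_eq_add_of_le h.le
      have h3 := ih (a + 2 ^ k) i (by rw [pow_succ] at hj; omega)
      set x := ‖s (a + 2 ^ k + i) - s (a + 2 ^ k)‖
      set y := ‖s (a + 2 ^ k) - s a‖
      have h4 : ‖s (a + (2 ^ k + i)) - s a‖ ≤ x + y := by
        rw [← add_assoc]
        calc _ = ‖(s (a + 2 ^ k + i) - s (a + 2 ^ k)) + (s (a + 2 ^ k) - s a)‖ := by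
              rw [sub_add_sub_cancel]
          _ ≤ _ := norm_add_le _ _
      have h5 : (x + y) ^ 2 ≤ ρ * x ^ 2 + κ * y ^ 2 := by
        have : ρ * x ^ 2 + κ * y ^ 2 - (x + y) ^ 2 = ((ρ - 1) * x - y) ^ 2 / (ρ - 1) := by
          rw [hκ]; field_simp; ring
        have h6 : 0 ≤ ((ρ - 1) * x - y) ^ 2 / (ρ - 1) := by positivity
        linarith
      have h7 : ‖s (a + (2 ^ k + i)) - s a‖ ^ 2 ≤ (x + y) ^ 2 := by gcongr
      nlinarith

lemma integral_dyadicBound_le {Ω : Type*} [MeasurableSpace Ω] {μ : Measure Ω} {ρ κ B : ℝ}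
    (hρ : 1 < ρ) (hκ : 1 ≤ κ) {s : Ω → ℕ → G} (hB : 0 ≤ B)
    (hs : ∀ a l, Integrable (fun ω => ‖s ω (a + l) - s ω a‖ ^ 2) μ)
    (hle : ∀ a l : ℕ, ∫ ω, ‖s ω (a + l) - s ω a‖ ^ 2 ∂μ ≤ B * l) (k a : ℕ) :
    Integrable (fun ω => dyadicBound ρ κ (s ω) k a) μ ∧
      ∫ ω, dyadicBound ρ κ (s ω) k a ∂μ ≤ B * κ * (k + 1) * (2 * ρ) ^ k := by
  induction k generalizing a with
  | zero =>
    refine ⟨hs a 1, ?_⟩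
    have := hle a 1
    simp only [dyadicBound]
    refine this.trans ?_
    simp
    nlinarith
  | succ k ih =>
    simp only [dyadicBound]
    have i1 : Integrable (fun ω => ρ * (dyadicBound ρ κ (s ω) k a +
        dyadicBound ρ κ (s ω) k (a + 2 ^ k))) μ :=
      ((ih a).1.add (ih (a + 2 ^ k)).1).const_mul _
    have i2 : Integrable (fun ω => κ * ‖s ω (a + 2 ^ k) - s ω a‖ ^ 2) μ :=
      (hs a (2 ^ k)).const_mul _
    refine ⟨i1.add i2, ?_⟩
    rw [integral_add i1 i2, integral_const_mul, integral_const_mul,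
      integral_add (ih a).1 (ih (a + 2 ^ k)).1]
    have h1 := (ih a).2
    have h2 := (ih (a + 2 ^ k)).2
    have h3 := hle a (2 ^ k)
    have h4 : (2 : ℝ) ^ k ≤ (2 * ρ) ^ (k + 1) := by
      calc (2 : ℝ) ^ k ≤ (2 * ρ) ^ k := by gcongr; linarith
        _ ≤ (2 * ρ) ^ (k + 1) := pow_le_pow_right₀ (by linarith) (Nat.le_succ k)
    push_cast at h3 ⊢
    calc _ ≤ ρ * (B * κ * (k + 1) * (2 * ρ) ^ k + B * κ * (k + 1) * (2 * ρ) ^ k) +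
          κ * (B * (2 * ρ) ^ (k + 1)) := by
          have : 0 ≤ ρ := by linarith
          have : 0 ≤ κ := by linarith
          gcongr
          exact h3.trans (by gcongr)
      _ = B * κ * (k + 1 + 1) * (2 * ρ) ^ (k + 1) := by ring

/-- Random sequences whose increments have linearly growing second moments grow almost surely
slower than any power exceeding `1 / 2`. -/
theorem ae_tendsto_rpow_mul_norm_div {Ω : Type*} [MeasurableSpace Ω] {μ : Measure Ω} {B : ℝ}
    {s : Ω → ℕ → G} (hB : 0 ≤ B) (hs0 : ∀ ω, s ω 0 = 0)
    (hs : ∀ a l, Integrable (fun ω => ‖s ω (a + l) - s ω a‖ ^ 2) μ)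
    (hle : ∀ a l : ℕ, ∫ ω, ‖s ω (a + l) - s ω a‖ ^ 2 ∂μ ≤ B * l) {ν : ℝ} (hν : ν < 1 / 2) :
    ∀ᵐ ω ∂μ, Tendsto (fun n : ℕ => (n : ℝ) ^ ν * ((n : ℝ)⁻¹ * ‖s ω n‖)) atTop (𝓝 0) := by
  -- This choice makes the ratio `r = 2 ρ q` equal to `2 ^ (-(1 - 2 ν) / 2) < 1`, where `q ^ k` is
  -- the squared normalisation `n ^ (2 ν - 2)` at `n = 2 ^ k`.
  set ρ : ℝ := 2 ^ ((1 - 2 * ν) / 2) with hρdef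
  have hρ : 1 < ρ := Real.one_lt_rpow (by norm_num) (by linarith)
  set κ : ℝ := ρ / (ρ - 1) with hκdef
  have hρ1 : 0 < ρ - 1 := by linarith
  have hκ : 1 ≤ κ := by rw [hκdef, le_div_iff₀ hρ1]; linarith
  set q : ℝ := 2 ^ (-(2 - 2 * ν)) with hq
  have hq0 : 0 < q := by positivity
  set r : ℝ := 2 * ρ * q with hr
  have hr0 : 0 < r := by positivity
  have hr1 : r < 1 := by
    have : r = 2 ^ (-((1 - 2 * ν) / 2)) := by
      rw [hr, hρdef, hq]
      nth_rewrite 1 [← Real.rpow_one 2]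
      rw [← Real.rpow_add (by norm_num), ← Real.rpow_add (by norm_num)]
      congr 1; ring
    rw [this]
    exact Real.rpow_lt_one_of_one_lt_of_neg (by norm_num) (by linarith)
  have hsum : Summable fun k : ℕ => B * κ * ((k + 1) * r ^ k) := by
    have h1 := summable_pow_mul_geometric_of_norm_lt_one 1
      (r := r) (by rwa [Real.norm_of_nonneg hr0.le])
    have h2 := summable_geometric_of_lt_one hr0.le hr1
    refine ((h1.add h2).congr fun k => ?_).mul_left _
    ring
  set W : ℕ → Ω → ℝ := fun k ω => q ^ k * dyadicBound ρ κ (s ω) k 0 with hW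
  have hWint : ∀ k, Integrable (W k) μ := fun k =>
    (integral_dyadicBound_le hρ hκ hB hs hle k 0).1.const_mul _
  have hW0 : ∀ k ω, 0 ≤ W k ω := fun k ω =>
    mul_nonneg (by positivity) (dyadicBound_nonneg (by linarith) (by linarith) _ _ _)
  have hWle : ∀ k : ℕ, ∫ ω, W k ω ∂μ ≤ B * κ * ((k + 1) * r ^ k) := by
    intro k
    simp only [hW]
    rw [integral_const_mul]
    calc _ ≤ q ^ k * (B * κ * (k + 1) * (2 * ρ) ^ k) := by
          gcongr
          exact (integral_dyadicBound_le hρ hκ hB hs hle k 0).2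
      _ = _ := by rw [hr, mul_pow]; ring
  -- The expectations are summable, so the series of the `W k` is almost surely finite.
  have hWae : ∀ᵐ ω ∂μ, Tendsto (fun k => W k ω) atTop (𝓝 0) := by
    have hfin : ∫⁻ ω, ∑' k, ENNReal.ofReal (W k ω) ∂μ ≠ ⊤ := by
      rw [lintegral_tsum fun k => (hWint k).aemeasurable.ennreal_ofReal]
      have h1 : ∀ k, ∫⁻ ω, ENNReal.ofReal (W k ω) ∂μ
          ≤ ENNReal.ofReal (B * κ * ((k + 1) * r ^ k)) := by
        intro k
        rw [← ofReal_integral_eq_lintegral_ofReal (hWint k) (Eventually.of_forall (hW0 k))]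
        exact ENNReal.ofReal_le_ofReal (hWle k)
      refine ne_top_of_le_ne_top ?_ (ENNReal.tsum_le_tsum h1)
      exact hsum.tsum_ofReal_ne_top
    filter_upwards [ae_lt_top' (AEMeasurable.tsum fun k =>
      (hWint k).aemeasurable.ennreal_ofReal) hfin] with ω hω
    have h1 := ENNReal.tendsto_atTop_zero_of_tsum_ne_top hω.ne
    have h2 := (ENNReal.tendsto_toReal ENNReal.zero_ne_top).comp h1
    simpa [Function.comp_def, ENNReal.toReal_ofReal (hW0 _ ω)] using h2
  filter_upwards [hWae] with ω hω
  have hlog : Tendsto (fun n : ℕ => Nat.log 2 n + 1) atTop atTop := by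
    refine tendsto_atTop.2 fun b => ?_
    filter_upwards [eventually_ge_atTop (2 ^ b)] with n hn
    exact (Nat.le_log_of_pow_le (by norm_num) hn).trans (Nat.le_succ _)
  have hsq : Tendsto (fun n : ℕ => ((n : ℝ) ^ ν * ((n : ℝ)⁻¹ * ‖s ω n‖)) ^ 2) atTop (𝓝 0) := by
    -- The weight is bounded at `2 ^ log n ≤ n`, the oscillation on the block up to `2 ^ (log n + 1)
    -- > n`; the mismatch of one level costs `q⁻¹`.
    have h1 := (hω.comp hlog).const_mul q⁻¹
    rw [mul_zero] at h1
    refine squeeze_zero' (Eventually.of_forall fun n => sq_nonneg _) ?_ h1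
    filter_upwards [eventually_ge_atTop 1] with n hn
    have hn0 : (0 : ℝ) < n := by exact_mod_cast hn
    have h2 : ‖s ω n‖ ^ 2 ≤ dyadicBound ρ κ (s ω) (Nat.log 2 n + 1) 0 := by
      have := norm_sub_sq_le_dyadicBound hρ hκdef (s ω) (Nat.log 2 n + 1) 0 n
        (Nat.lt_pow_succ_log_self (by norm_num) n).le
      simpa [hs0] using this
    have h3 : ((n : ℝ) ^ ν * (n : ℝ)⁻¹) ^ 2 = (n : ℝ) ^ (-(2 - 2 * ν)) := by
      rw [← Real.rpow_neg_one, ← Real.rpow_add hn0, ← Real.rpow_natCast, ← Real.rpow_mul hn0.le]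
      congr 1; push_cast; ring
    have h4 : (n : ℝ) ^ (-(2 - 2 * ν)) ≤ q ^ Nat.log 2 n := by
      have h5 : ((2 : ℝ) ^ Nat.log 2 n) ≤ n := by
        exact_mod_cast Nat.pow_log_le_self 2 (by omega)
      calc _ ≤ ((2 : ℝ) ^ Nat.log 2 n) ^ (-(2 - 2 * ν)) :=
            Real.rpow_le_rpow_of_nonpos (by positivity) h5 (by linarith)
        _ = _ := by
            rw [hq, ← Real.rpow_natCast, ← Real.rpow_natCast, ← Real.rpow_mul (by norm_num),
              ← Real.rpow_mul (by norm_num), mul_comm]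
    calc ((n : ℝ) ^ ν * ((n : ℝ)⁻¹ * ‖s ω n‖)) ^ 2
        = ((n : ℝ) ^ ν * (n : ℝ)⁻¹) ^ 2 * ‖s ω n‖ ^ 2 := by ring
      _ ≤ q ^ Nat.log 2 n * dyadicBound ρ κ (s ω) (Nat.log 2 n + 1) 0 := by
          rw [h3]; gcongr
      _ = q⁻¹ * W (Nat.log 2 n + 1) ω := by
          simp only [hW, pow_succ]; field_simp
  have := hsq.sqrt
  simp only [Real.sqrt_zero] at this
  refine this.congr fun n => Real.sqrt_sq ?_
  have : (0 : ℝ) ≤ (n : ℝ) ^ ν := Real.rpow_nonneg (Nat.cast_nonneg _) _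
  positivity

end Chaining

/-! ### A law of large numbers with rate under weak measurability -/

section Averages

variable {E G : Type*} [MeasurableSpace E] [NormedAddCommGroup G] [InnerProductSpace ℝ G]
  [CompleteSpace G]

/-- Neither separability of `G` nor measurability of `ψ` is assumed. Projecting `w` to the closed
span of the range of `ψ` changes no inner product, and there `w` is a sequential limit of
combinations of the `ψ z'`. -/
lemma measurable_inner_of_gram {ψ : E → G}
    (hψ : Measurable fun p : E × E => inner ℝ (ψ p.1) (ψ p.2)) (w : G) :
    Measurable fun z => inner ℝ (ψ z) w := by
  set V := (Submodule.span ℝ (Set.range ψ)).topologicalClosure with hV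
  have hVc : IsClosed (V : Set G) := Submodule.isClosed_topologicalClosure _
  have : CompleteSpace V := hVc.completeSpace_coe
  obtain ⟨v, hv, u, hu, rfl⟩ := V.exists_add_mem_mem_orthogonal w
  have h1 : ∀ z, inner ℝ (ψ z) (v + u) = inner ℝ (ψ z) v := by
    intro z
    have hz : ψ z ∈ V := Submodule.le_topologicalClosure _ (Submodule.subset_span ⟨z, rfl⟩)
    rw [inner_add_right, Submodule.inner_right_of_mem_orthogonal hz hu, add_zero]
  simp only [h1]
  have hspan : ∀ x ∈ Submodule.span ℝ (Set.range ψ), Measurable fun z => inner ℝ (ψ z) x := by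
    intro x hx
    induction hx using Submodule.span_induction with
    | mem x hx =>
      obtain ⟨z', rfl⟩ := hx
      exact hψ.comp (measurable_id.prodMk measurable_const)
    | zero => simp
    | add x y _ _ hx hy => simp only [inner_add_right]; exact hx.add hy
    | smul a x _ hx => simp only [real_inner_smul_right]; exact hx.const_mul a
  rw [← SetLike.mem_coe, hV, Submodule.topologicalClosure_coe, mem_closure_iff_seq_limit] at hv
  obtain ⟨x, hx, hxv⟩ := hv
  refine measurable_of_tendsto_metrizable (fun n => hspan (x n) (hx n)) ?_
  exact tendsto_pi_nhds.2 fun z => tendsto_const_nhds.inner hxv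

lemma integrable_inner_of_gram {P : Measure E} [IsFiniteMeasure P] {ψ : E → G} {C : ℝ}
    (hψ : Measurable fun p : E × E => inner ℝ (ψ p.1) (ψ p.2)) (hC : ∀ z, ‖ψ z‖ ≤ C) (w : G) :
    Integrable (fun z => inner ℝ (ψ z) w) P := by
  refine Integrable.of_bound (measurable_inner_of_gram hψ w).aestronglyMeasurable (C * ‖w‖)
    (Eventually.of_forall fun z => ?_)
  calc _ ≤ ‖ψ z‖ * ‖w‖ := norm_inner_le_norm _ _
    _ ≤ _ := by gcongr; exact hC z

/-- Existence of the weak mean of a bounded feature map. -/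
lemma exists_weak_mean (P : Measure E) [IsProbabilityMeasure P] {ψ : E → G} {C : ℝ}
    (hψ : Measurable fun p : E × E => inner ℝ (ψ p.1) (ψ p.2)) (hC : ∀ z, ‖ψ z‖ ≤ C) :
    ∃ m : G, ∀ w, ∫ z, inner ℝ (ψ z) w ∂P = inner ℝ m w := by
  -- The mean is a Riesz representative; a Bochner integral would need strong measurability of `ψ`.
  let L : G →ₗ[ℝ] ℝ :=
    { toFun := fun w => ∫ z, inner ℝ (ψ z) w ∂P
      map_add' := fun v w => by
        simp only [inner_add_right]
        exact integral_add (integrable_inner_of_gram hψ hC v) (integrable_inner_of_gram hψ hC w)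
      map_smul' := fun a w => by
        simp only [real_inner_smul_right, integral_const_mul]; rfl }
  have hL : ∀ w, ‖L w‖ ≤ C * ‖w‖ := by
    intro w
    have := norm_integral_le_of_norm_le_const (μ := P) (f := fun z => inner ℝ (ψ z) w)
      (C := C * ‖w‖) (Eventually.of_forall fun z => by
        calc _ ≤ ‖ψ z‖ * ‖w‖ := norm_inner_le_norm _ _
          _ ≤ _ := by gcongr; exact hC z)
    simpa [L] using this
  refine ⟨(InnerProductSpace.toDual ℝ G).symm (L.mkContinuous C hL), fun w => ?_⟩
  rw [InnerProductSpace.toDual_symm_apply]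
  rfl

variable {Ω : Type*} [MeasurableSpace Ω] {μ : Measure Ω} [IsProbabilityMeasure μ]
  {P : Measure E} [IsProbabilityMeasure P] {Z : ℕ → Ω → E}

/-- Strong law of large numbers with a rate for a bounded feature map with measurable kernel. -/
theorem ae_tendsto_rpow_mul_norm_average {ψ : E → G} {C : ℝ}
    (hψ : Measurable fun p : E × E => inner ℝ (ψ p.1) (ψ p.2)) (hC : ∀ z, ‖ψ z‖ ≤ C) {m : G}
    (hm : ∀ w, ∫ z, inner ℝ (ψ z) w ∂P = inner ℝ m w)
    (hZ : ∀ i, Measurable (Z i)) (hlaw : ∀ i, μ.map (Z i) = P) (hindep : iIndepFun Z μ)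
    {ν : ℝ} (hν : ν < 1 / 2) :
    ∀ᵐ ω ∂μ, Tendsto (fun n : ℕ => (n : ℝ) ^ ν *
      ‖(n : ℝ)⁻¹ • ∑ i ∈ Finset.range n, ψ (Z i ω) - m‖) atTop (𝓝 0) := by
  set D : ℝ := C + ‖m‖ with hD
  set h : E × E → ℝ := fun p => inner ℝ (ψ p.1 - m) (ψ p.2 - m) with hh
  have hmeas : Measurable h := by
    have h1 := measurable_inner_of_gram hψ m
    simp only [hh, inner_sub_left, inner_sub_right, real_inner_comm _ m]
    exact (hψ.sub (h1.comp measurable_snd)).sub ((h1.comp measurable_fst).sub measurable_const)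
  have hnorm : ∀ z, ‖ψ z - m‖ ≤ D := fun z =>
    (norm_sub_le _ _).trans (by rw [hD]; gcongr; exact hC z)
  have hbound : ∀ p, ‖h p‖ ≤ D * D := fun p =>
    calc ‖h p‖ ≤ ‖ψ p.1 - m‖ * ‖ψ p.2 - m‖ := norm_inner_le_norm _ _
      _ ≤ D * D := by
        gcongr
        · exact (norm_nonneg _).trans (hnorm p.1)
        · exact hnorm _
        · exact hnorm _
  have hint : ∀ i j, Integrable (fun ω => h (Z i ω, Z j ω)) μ := fun i j =>
    Integrable.of_bound (hmeas.comp ((hZ i).prodMk (hZ j))).aestronglyMeasurable (D * D)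
      (Eventually.of_forall fun ω => hbound _)
  -- Independent centred terms are orthogonal in mean: under `P.prod P` the inner integral vanishes
  -- by the definition of `m`. Only diagonal terms remain in the second moments of increments.
  have hzero : ∀ i j, i ≠ j → ∫ ω, h (Z i ω, Z j ω) ∂μ = 0 := by
    intro i j hij
    have hmap : μ.map (fun ω => (Z i ω, Z j ω)) = P.prod P := by
      rw [(indepFun_iff_map_prod_eq_prod_map_map (hZ i).aemeasurable (hZ j).aemeasurable).1
        (hindep.indepFun hij), hlaw, hlaw]
    have h1 : ∫ ω, h (Z i ω, Z j ω) ∂μ = ∫ p, h p ∂(P.prod P) := by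
      rw [← hmap, integral_map ((hZ i).prodMk (hZ j)).aemeasurable hmeas.aestronglyMeasurable]
    rw [h1, integral_prod _ (Integrable.of_bound hmeas.aestronglyMeasurable (D * D)
      (Eventually.of_forall hbound))]
    refine integral_eq_zero_of_ae (Eventually.of_forall fun z => ?_)
    have h2 : ∀ z', h (z, z') = inner ℝ (ψ z') (ψ z - m) - inner ℝ m (ψ z - m) := by
      intro z'
      simp only [hh]
      rw [real_inner_comm, inner_sub_left]
    simp only [h2, Pi.zero_apply]
    rw [integral_sub (integrable_inner_of_gram hψ hC _) (integrable_const _), hm]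
    simp
  set s : Ω → ℕ → G := fun ω n => ∑ i ∈ Finset.range n, (ψ (Z i ω) - m) with hs
  have hsq : ∀ a l ω, ‖s ω (a + l) - s ω a‖ ^ 2 =
      ∑ i ∈ Finset.range l, ∑ j ∈ Finset.range l, h (Z (a + i) ω, Z (a + j) ω) := by
    intro a l ω
    have : s ω (a + l) - s ω a = ∑ i ∈ Finset.range l, (ψ (Z (a + i) ω) - m) := by
      simp only [hs]
      rw [Finset.sum_range_add]
      abel
    rw [this, ← real_inner_self_eq_norm_sq, sum_inner]
    refine Finset.sum_congr rfl fun i _ => ?_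
    rw [inner_sum]
  have hsint : ∀ a l, Integrable (fun ω => ‖s ω (a + l) - s ω a‖ ^ 2) μ := by
    intro a l
    simp only [hsq]
    exact integrable_finsetSum _ fun i _ => integrable_finsetSum _ fun j _ => hint _ _
  have hsle : ∀ a l : ℕ, ∫ ω, ‖s ω (a + l) - s ω a‖ ^ 2 ∂μ ≤ (D * D) * l := by
    intro a l
    simp only [hsq]
    rw [integral_finsetSum _ fun i _ => integrable_finsetSum _ fun j _ => hint _ _]
    calc _ ≤ ∑ _i ∈ Finset.range l, D * D := by
          refine Finset.sum_le_sum fun i hi => ?_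
          rw [integral_finsetSum _ fun j _ => hint _ _, Finset.sum_eq_single i
            (fun j _ hj => hzero _ _ (by omega)) (fun h' => absurd hi h')]
          have := norm_integral_le_of_norm_le_const (μ := μ)
            (f := fun ω => h (Z (a + i) ω, Z (a + i) ω)) (C := D * D)
            (Eventually.of_forall fun ω => hbound _)
          simp only [probReal_univ, mul_one] at this
          exact (le_abs_self _).trans this
      _ = _ := by simp [mul_comm]
  filter_upwards [ae_tendsto_rpow_mul_norm_div (mul_self_nonneg D) (fun ω => by simp [hs]) hsint
    hsle hν] with ω hω
  refine hω.congr' ?_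
  filter_upwards [eventually_ge_atTop 1] with n hn
  have hn0 : (n : ℝ) ≠ 0 := by positivity
  congr 1
  have : (n : ℝ)⁻¹ • ∑ i ∈ Finset.range n, ψ (Z i ω) - m = (n : ℝ)⁻¹ • s ω n := by
    simp only [hs, Finset.sum_sub_distrib, smul_sub, Finset.sum_const, Finset.card_range]
    rw [← Nat.cast_smul_eq_nsmul ℝ, smul_smul, inv_mul_cancel₀ hn0, one_smul]
  rw [this, norm_smul, Real.norm_of_nonneg (by positivity)]

end Averages

/-! ### Operator norms bounded through the Hilbert tensor square -/

section TensorSquare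

open scoped TensorProduct

variable {H : Type*} [NormedAddCommGroup H] [InnerProductSpace ℝ H]

/-- The difference of two operators is bounded by a vector representing it on the tensor square. -/
lemma norm_sub_le_of_tensor (S S' : H →L[ℝ] H) (ξ ξ' : UniformSpace.Completion (H ⊗[ℝ] H))
    (h : ∀ v w, inner ℝ ξ ((v ⊗ₜ[ℝ] w : H ⊗[ℝ] H) : UniformSpace.Completion (H ⊗[ℝ] H))
      = inner ℝ v (S w))
    (h' : ∀ v w, inner ℝ ξ' ((v ⊗ₜ[ℝ] w : H ⊗[ℝ] H) : UniformSpace.Completion (H ⊗[ℝ] H))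
      = inner ℝ v (S' w)) : ‖S - S'‖ ≤ ‖ξ - ξ'‖ := by
  refine ContinuousLinearMap.opNorm_le_bound _ (norm_nonneg _) fun w => ?_
  -- Testing the representing vector against `v ⊗ w` with `v = (S - S') w` yields `‖v‖²`, and one
  -- factor `‖v‖` cancels.
  set v := (S - S') w with hv
  have h1 : ‖v‖ * ‖v‖ ≤ (‖ξ - ξ'‖ * ‖w‖) * ‖v‖ := by
    calc ‖v‖ * ‖v‖ = inner ℝ v ((S - S') w) := by rw [← hv, real_inner_self_eq_norm_mul_norm]
      _ = inner ℝ (ξ - ξ')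
          ((v ⊗ₜ[ℝ] w : H ⊗[ℝ] H) : UniformSpace.Completion (H ⊗[ℝ] H)) := by
        rw [sub_apply, inner_sub_right, inner_sub_left, h, h']
      _ ≤ ‖ξ - ξ'‖ * ‖((v ⊗ₜ[ℝ] w : H ⊗[ℝ] H) : UniformSpace.Completion (H ⊗[ℝ] H))‖ :=
        real_inner_le_norm _ _
      _ = (‖ξ - ξ'‖ * ‖w‖) * ‖v‖ := by
        rw [UniformSpace.Completion.norm_coe, TensorProduct.norm_tmul]; ring
  rcases (norm_nonneg v).eq_or_lt with h0 | h0
  · rw [← h0]; positivity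
  · exact le_of_mul_le_mul_right h1 h0

end TensorSquare

/-! ### The inclusion of the kernel space into `L²` -/

section RKHS

lemma abs_apply_le {X H : Type*} [NormedAddCommGroup H] [InnerProductSpace ℝ H]
    [CompleteSpace H] [RKHS ℝ H X ℝ] (hBk : ∀ x : X, realKernel H x x ≤ 1) (g : H) (x : X) : |g x| ≤ ‖g‖ := by
  rw [← inner_feature]
  calc _ ≤ ‖feature H x‖ * ‖g‖ := abs_real_inner_le_norm _ _
    _ ≤ 1 * ‖g‖ := by gcongr; exact norm_feature_le H hBk x
    _ = ‖g‖ := one_mul _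

variable {X : Type*} [MeasurableSpace X] {H : Type*} [NormedAddCommGroup H]
  [InnerProductSpace ℝ H] [CompleteSpace H] [RKHS ℝ H X ℝ]

lemma measurable_inner_feature (hk : Measurable fun p : X × X => realKernel H p.1 p.2) :
    Measurable fun p : X × X => inner ℝ (feature H p.1) (feature H p.2) := by
  simpa only [realKernel_eq_inner] using hk

lemma measurable_realKernel_fst (hk : Measurable fun p : X × X => realKernel H p.1 p.2) :
    Measurable fun p : (X × ℝ) × (X × ℝ) => realKernel H p.1.1 p.2.1 := by
  have h : Measurable fun p : (X × ℝ) × (X × ℝ) => (p.1.1, p.2.1) :=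
    (measurable_fst.comp measurable_fst).prodMk (measurable_fst.comp measurable_snd)
  have h2 := hk.comp h
  simpa only [Function.comp_def] using h2

lemma measurable_coe (hk : Measurable fun p : X × X => realKernel H p.1 p.2) (g : H) :
    Measurable (g : X → ℝ) := by
  have := measurable_inner_of_gram (measurable_inner_feature hk) g
  simpa only [inner_feature] using this

lemma memLp_coe (hk : Measurable fun p : X × X => realKernel H p.1 p.2)
    (hBk : ∀ x : X, realKernel H x x ≤ 1) (Q : Measure X) [IsFiniteMeasure Q] (g : H) :
    MemLp (g : X → ℝ) 2 Q :=
  MemLp.of_bound (measurable_coe hk g).aestronglyMeasurable ‖g‖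
    (Eventually.of_forall fun x => abs_apply_le hBk g x)

lemma norm_toLp_coe_le (hk : Measurable fun p : X × X => realKernel H p.1 p.2)
    (hBk : ∀ x : X, realKernel H x x ≤ 1) (Q : Measure X) [IsProbabilityMeasure Q] (g : H) :
    ‖(memLp_coe hk hBk Q g).toLp g‖ ≤ 1 * ‖g‖ := by
  have h := Lp.norm_le_of_ae_bound (f := (memLp_coe hk hBk Q g).toLp g) (norm_nonneg g) (by
    filter_upwards [(memLp_coe hk hBk Q g).coeFn_toLp] with x hx
    rw [hx]
    exact abs_apply_le hBk g x)
  have h1 : measureUnivNNReal Q = 1 := by simp [measureUnivNNReal]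
  simpa only [h1, NNReal.coe_one, Real.one_rpow] using h

/-- The inclusion of the reproducing kernel Hilbert space into `L²(Q)`, as a linear map. -/
noncomputable def inclusionL2Aux (hk : Measurable fun p : X × X => realKernel H p.1 p.2)
    (hBk : ∀ x : X, realKernel H x x ≤ 1) (Q : Measure X) [IsProbabilityMeasure Q] :
    H →ₗ[ℝ] Lp ℝ 2 Q where
  toFun g := (memLp_coe hk hBk Q g).toLp g
  map_add' g h := by
    rw [← MemLp.toLp_add]
    exact MemLp.toLp_congr _ _ (by rw [RKHS.coe_add])
  map_smul' a g := by
    rw [RingHom.id_apply, ← MemLp.toLp_const_smul]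
    exact MemLp.toLp_congr _ _ (by rw [RKHS.coe_smul])

/-- The inclusion of the reproducing kernel Hilbert space into `L²(Q)`. -/
noncomputable def inclusionL2 (hk : Measurable fun p : X × X => realKernel H p.1 p.2)
    (hBk : ∀ x : X, realKernel H x x ≤ 1) (Q : Measure X) [IsProbabilityMeasure Q] :
    H →L[ℝ] Lp ℝ 2 Q :=
  (inclusionL2Aux hk hBk Q).mkContinuous 1 (norm_toLp_coe_le hk hBk Q)

lemma inclusionL2_apply (hk : Measurable fun p : X × X => realKernel H p.1 p.2)
    (hBk : ∀ x : X, realKernel H x x ≤ 1) (Q : Measure X) [IsProbabilityMeasure Q] (g : H) :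
    inclusionL2 hk hBk Q g = (memLp_coe hk hBk Q g).toLp g := rfl

lemma denseRange_inclusionL2 (hk : Measurable fun p : X × X => realKernel H p.1 p.2)
    (hBk : ∀ x : X, realKernel H x x ≤ 1) (hU : IsUniversal H (X := X)) (Q : Measure X)
    [IsProbabilityMeasure Q] : DenseRange (inclusionL2 (H := H) hk hBk Q) := by
  refine (hU Q inferInstance).mono ?_
  rintro f ⟨g, hg⟩
  exact ⟨g, Lp.ext ((memLp_coe hk hBk Q g).coeFn_toLp.trans hg.symm)⟩

lemma inner_toLp_inclusionL2 (hk : Measurable fun p : X × X => realKernel H p.1 p.2)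
    (hBk : ∀ x : X, realKernel H x x ≤ 1) (Q : Measure X) [IsProbabilityMeasure Q] {F : X → ℝ}
    (hF : MemLp F 2 Q) (g : H) :
    inner ℝ (hF.toLp F) (inclusionL2 hk hBk Q g) = ∫ x, F x * g x ∂Q := by
  rw [L2.inner_def]
  refine integral_congr_ae ?_
  filter_upwards [hF.coeFn_toLp, (memLp_coe hk hBk Q g).coeFn_toLp] with x h1 h2
  rw [h1, inclusionL2_apply, h2]
  simp [mul_comm]

/-- The deterministic theorem along one sample path, with `J` the inclusion. The target `F` enters
only through the limit of `T* y`, so both parts of the main theorem use it. -/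
lemma tendsto_eLpNorm_sub_estimate (hk : Measurable fun p : X × X => realKernel H p.1 p.2)
    (hBk : ∀ x : X, realKernel H x x ≤ 1) (hU : IsUniversal H (X := X)) (Q : Measure X)
    [IsProbabilityMeasure Q] {F : X → ℝ} (hF : MemLp F 2 Q) {ν : ℝ} (hν : 0 < ν)
    (x : ∀ n : ℕ, Fin n → X) (y : ∀ n : ℕ, Fin n → ℝ)
    (hS : Tendsto (fun n : ℕ => (n : ℝ) ^ ν * ‖empCovL H (x n) -
      (inclusionL2 hk hBk Q).adjoint ∘L inclusionL2 hk hBk Q‖) atTop (𝓝 0))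
    (hb : Tendsto (fun n : ℕ => (n : ℝ) ^ ν * ‖empAdj H (x n) (y n) -
      (inclusionL2 hk hBk Q).adjoint (hF.toLp F)‖) atTop (𝓝 0)) :
    Tendsto (fun n : ℕ => eLpNorm (fun t => F t - estimate H ν (x n) (y n) t) 2 Q)
      atTop (𝓝 0) := by
  have h := tendsto_norm_sub_galerkin (denseRange_inclusionL2 hk hBk hU Q) (hF.toLp F) hν
    (fun n => empCovL_symm H (x n))
    (fun n v => by
      rw [real_inner_comm, inner_empCovL]
      exact mul_nonneg (by positivity) (Finset.sum_nonneg fun i _ => mul_self_nonneg _))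
    (fun n => norm_empCovL_le H hBk (x n)) hS hb
    (fun n => run_g_mem_krylov H (x n) (y n) (firstTime H ν (x n) (y n) - 1))
    (fun n v hv => inner_residual_run H (x n) (y n) _ hv)
    (fun n => (firstTime_spec H ν (x n) (y n)).1) (fun n => (firstTime_spec H ν (x n) (y n)).2)
  have h' := ENNReal.tendsto_ofReal h
  rw [ENNReal.ofReal_zero] at h'
  refine h'.congr fun n => ?_
  rw [inclusionL2_apply, ← MemLp.toLp_sub, Lp.norm_toLp,
    ENNReal.ofReal_toReal (hF.sub (memLp_coe hk hBk Q _)).eLpNorm_ne_top]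
  rfl

end RKHS

/-! ### The regression function as a conditional mean -/

section Regression

variable {X : Type*} [MeasurableSpace X] {P : Measure (X × ℝ)} [IsProbabilityMeasure P]

lemma ae_abs_regression_le (hBY : ∀ᵐ z ∂P, z.2 ∈ Set.Icc (-1 : ℝ) 1) :
    ∀ᵐ x ∂P.fst, |regression P x| ≤ 1 := by
  rw [← P.disintegrate P.condKernel] at hBY
  filter_upwards [Measure.ae_ae_of_ae_compProd hBY] with x hx
  have := norm_integral_le_of_norm_le_const (μ := P.condKernel x) (f := fun y => y) (C := 1) (by
    filter_upwards [hx] with y hy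
    exact abs_le.2 hy)
  simpa [regression] using this

lemma memLp_regression (hBY : ∀ᵐ z ∂P, z.2 ∈ Set.Icc (-1 : ℝ) 1) :
    MemLp (regression P) 2 P.fst := by
  refine MemLp.of_bound ?_ 1 (ae_abs_regression_le hBY)
  exact AEStronglyMeasurable.integral_condKernel (ρ := P) (f := fun z : X × ℝ => z.2)
    measurable_snd.aestronglyMeasurable

lemma integral_regression_mul (hBY : ∀ᵐ z ∂P, z.2 ∈ Set.Icc (-1 : ℝ) 1) {g : X → ℝ} {C : ℝ}
    (hg : Measurable g) (hC : ∀ x, |g x| ≤ C) :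
    ∫ x, regression P x * g x ∂P.fst = ∫ z, z.2 * g z.1 ∂P := by
  have hint : Integrable (fun z : X × ℝ => z.2 * g z.1) P := by
    refine Integrable.of_bound
      (measurable_snd.mul (hg.comp measurable_fst)).aestronglyMeasurable (1 * C) ?_
    filter_upwards [hBY] with z hz
    rw [norm_mul]
    exact mul_le_mul (abs_le.2 hz) (hC _) (norm_nonneg _) zero_le_one
  rw [← Measure.integral_condKernel hint]
  simp only [integral_mul_const]
  rfl

end Regression

/-! ### Rates for the empirical operators -/

section Sampling

open scoped TensorProduct

variable {X : Type*} [MeasurableSpace X] {H : Type*} [NormedAddCommGroup H]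
  [InnerProductSpace ℝ H] [CompleteSpace H] [RKHS ℝ H X ℝ]
  {P : Measure (X × ℝ)} [IsProbabilityMeasure P]
  {Ω : Type*} [MeasurableSpace Ω] {μ : Measure Ω} [IsProbabilityMeasure μ] {Z : ℕ → Ω → X × ℝ}

/-- Convergence with a rate of the empirical covariance operators. -/
lemma ae_tendsto_empCovL (hk : Measurable fun p : X × X => realKernel H p.1 p.2)
    (hBk : ∀ x : X, realKernel H x x ≤ 1) (hZ : ∀ i, Measurable (Z i))
    (hlaw : ∀ i, μ.map (Z i) = P) (hindep : iIndepFun Z μ) {ν : ℝ} (hν : ν < 1 / 2) :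
    ∀ᵐ ω ∂μ, Tendsto (fun n : ℕ => (n : ℝ) ^ ν * ‖empCovL H (fun i : Fin n => (Z i ω).1) -
      (inclusionL2 hk hBk P.fst).adjoint ∘L inclusionL2 hk hBk P.fst‖) atTop (𝓝 0) := by
  -- `k(x, ·) ⊗ k(x, ·)` encodes a rank one operator as a vector of a Hilbert space. Its kernel
  -- `k(x, x')²` is measurable, so the averaging theorem applies.
  set ψ : X × ℝ → UniformSpace.Completion (H ⊗[ℝ] H) := fun z =>
    ((feature H z.1 ⊗ₜ[ℝ] feature H z.1 : H ⊗[ℝ] H) :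
      UniformSpace.Completion (H ⊗[ℝ] H)) with hψdef
  have hinner : ∀ z v w, inner ℝ (ψ z)
      ((v ⊗ₜ[ℝ] w : H ⊗[ℝ] H) : UniformSpace.Completion (H ⊗[ℝ] H)) = v z.1 * w z.1 := by
    intro z v w
    rw [hψdef, UniformSpace.Completion.inner_coe, TensorProduct.inner_tmul, inner_feature,
      inner_feature]
  have hψ : Measurable fun p : (X × ℝ) × (X × ℝ) => inner ℝ (ψ p.1) (ψ p.2) := by
    have h1 := measurable_realKernel_fst hk
    have h2 : ∀ p : (X × ℝ) × (X × ℝ), inner ℝ (ψ p.1) (ψ p.2) =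
        realKernel H p.1.1 p.2.1 * realKernel H p.1.1 p.2.1 := by
      intro p
      rw [show inner ℝ (ψ p.1) (ψ p.2) = _ from hinner p.1 _ _, realKernel_eq_inner, inner_feature]
    simp only [h2]
    exact h1.mul h1
  have hC : ∀ z, ‖ψ z‖ ≤ 1 := by
    intro z
    rw [hψdef, UniformSpace.Completion.norm_coe, TensorProduct.norm_tmul]
    exact mul_le_one₀ (norm_feature_le H hBk _) (norm_nonneg _) (norm_feature_le H hBk _)
  obtain ⟨m, hm⟩ := exists_weak_mean P hψ hC
  filter_upwards [ae_tendsto_rpow_mul_norm_average hψ hC hm hZ hlaw hindep hν] with ω hω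
  refine squeeze_zero (fun n => by positivity) (fun n => ?_) hω
  have hn : (0 : ℝ) ≤ (n : ℝ) ^ ν := by positivity
  refine mul_le_mul_of_nonneg_left (norm_sub_le_of_tensor _ _ _ _ (fun v w => ?_)
    (fun v w => ?_)) hn
  · rw [← empCovL_symm, inner_empCovL, real_inner_smul_left, sum_inner, Finset.sum_range]
    simp only [hinner]
  · rw [← hm, ContinuousLinearMap.comp_apply, ContinuousLinearMap.adjoint_inner_right,
      inclusionL2_apply hk hBk P.fst v, inner_toLp_inclusionL2]
    simp only [hinner]
    exact (integral_map (f := fun x => v x * w x) measurable_fst.aemeasurable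
      ((measurable_coe hk v).mul (measurable_coe hk w)).aestronglyMeasurable).symm

/-- Convergence with a rate of the empirical means of `Y k(X, ·)`. -/
lemma ae_tendsto_empAdj (hk : Measurable fun p : X × X => realKernel H p.1 p.2)
    (hBk : ∀ x : X, realKernel H x x ≤ 1) {c : X × ℝ → ℝ} (hc : Measurable c)
    (hc1 : ∀ z, |c z| ≤ 1) {F : X → ℝ} (hF : MemLp F 2 P.fst)
    (hcF : ∀ g : H, ∫ z, c z * g z.1 ∂P = ∫ x, F x * g x ∂P.fst) (hZ : ∀ i, Measurable (Z i))
    (hlaw : ∀ i, μ.map (Z i) = P) (hindep : iIndepFun Z μ) {ν : ℝ} (hν : ν < 1 / 2) :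
    ∀ᵐ ω ∂μ, Tendsto (fun n : ℕ => (n : ℝ) ^ ν *
      ‖empAdj H (fun i : Fin n => (Z i ω).1) (fun i : Fin n => c (Z i ω)) -
        (inclusionL2 hk hBk P.fst).adjoint (hF.toLp F)‖) atTop (𝓝 0) := by
  set ψ : X × ℝ → H := fun z => c z • feature H z.1 with hψdef
  have hψ : Measurable fun p : (X × ℝ) × (X × ℝ) => inner ℝ (ψ p.1) (ψ p.2) := by
    have h1 := measurable_realKernel_fst hk
    simp only [hψdef, real_inner_smul_left, real_inner_smul_right, ← realKernel_eq_inner]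
    exact (hc.comp measurable_snd).mul ((hc.comp measurable_fst).mul h1)
  have hC : ∀ z, ‖ψ z‖ ≤ 1 := by
    intro z
    rw [hψdef, norm_smul]
    exact mul_le_one₀ (hc1 z) (norm_nonneg _) (norm_feature_le H hBk _)
  have hm : ∀ g, ∫ z, inner ℝ (ψ z) g ∂P =
      inner ℝ ((inclusionL2 hk hBk P.fst).adjoint (hF.toLp F)) g := by
    intro g
    rw [ContinuousLinearMap.adjoint_inner_left, inner_toLp_inclusionL2, ← hcF]
    simp only [hψdef, real_inner_smul_left, inner_feature]
  filter_upwards [ae_tendsto_rpow_mul_norm_average hψ hC hm hZ hlaw hindep hν] with ω hω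
  refine hω.congr fun n => ?_
  rw [Finset.sum_range]
  rfl

end Sampling

/-! ### Truncation and empirical centring of the responses -/

section Centering

variable {X : Type*} [MeasurableSpace X] {P : Measure (X × ℝ)} [IsProbabilityMeasure P]
  {Ω : Type*} [MeasurableSpace Ω] {μ : Measure Ω} [IsProbabilityMeasure μ] {Z : ℕ → Ω → X × ℝ}

/-- The response, truncated to `[-1, 1]`. -/
noncomputable def clip (z : X × ℝ) : ℝ := max (-1) (min 1 z.2)

lemma measurable_clip : Measurable (clip : X × ℝ → ℝ) :=
  measurable_const.max (measurable_const.min measurable_snd)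

lemma abs_clip_le {X : Type*} (z : X × ℝ) : |clip z| ≤ 1 :=
  abs_le.2 ⟨le_max_left _ _, max_le (by norm_num) (min_le_left _ _)⟩

lemma clip_eq {X : Type*} {z : X × ℝ} (hz : z.2 ∈ Set.Icc (-1 : ℝ) 1) : clip z = z.2 := by
  rw [clip, min_eq_right hz.2, max_eq_right hz.1]

/-- Convergence with a rate of the empirical means of bounded functions. -/
lemma ae_tendsto_average {c : X × ℝ → ℝ} (hc : Measurable c) (hc1 : ∀ z, |c z| ≤ 1)
    (hZ : ∀ i, Measurable (Z i)) (hlaw : ∀ i, μ.map (Z i) = P) (hindep : iIndepFun Z μ) {ν : ℝ}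
    (hν : ν < 1 / 2) :
    ∀ᵐ ω ∂μ, Tendsto (fun n : ℕ => (n : ℝ) ^ ν *
      |(n : ℝ)⁻¹ * ∑ i : Fin n, c (Z i ω) - ∫ z, c z ∂P|) atTop (𝓝 0) := by
  have hψ : Measurable fun p : (X × ℝ) × (X × ℝ) => inner ℝ (c p.1) (c p.2) :=
    (hc.comp measurable_snd).mul (hc.comp measurable_fst)
  have hm : ∀ w : ℝ, ∫ z, inner ℝ (c z) w ∂P = inner ℝ (∫ z, c z ∂P) w := by
    intro w
    simp only [RCLike.inner_apply, conj_trivial]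
    rw [integral_const_mul]
  filter_upwards [ae_tendsto_rpow_mul_norm_average hψ hc1 hm hZ hlaw hindep hν] with ω hω
  refine hω.congr fun n => ?_
  rw [Finset.sum_range, smul_eq_mul, Real.norm_eq_abs]

/-- Centring couples the observations; this splits it into averages of independent terms, each with
its own rate. -/
lemma empAdj_center {H : Type*} [NormedAddCommGroup H] [InnerProductSpace ℝ H] [CompleteSpace H]
    {X : Type*} [RKHS ℝ H X ℝ] {n : ℕ} (x : Fin n → X) (y : Fin n → ℝ) :
    empAdj H x (center y) =
      empAdj H x y - ((n : ℝ)⁻¹ * ∑ j, y j) • empAdj H x (fun _ => 1) := by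
  simp only [empAdj, center, sub_smul, Finset.sum_sub_distrib, smul_sub, ← Finset.smul_sum,
    one_smul]
  rw [smul_comm]

/-- Rates of convergence are inherited by differences of products. -/
lemma tendsto_rate_sub_smul {H : Type*} [NormedAddCommGroup H] [NormedSpace ℝ H] {ν : ℝ}
    (hν : 0 < ν) {a v : ℕ → H} {t : ℕ → ℝ} {a₀ v₀ : H} {t₀ : ℝ}
    (ha : Tendsto (fun n : ℕ => (n : ℝ) ^ ν * ‖a n - a₀‖) atTop (𝓝 0))
    (hv : Tendsto (fun n : ℕ => (n : ℝ) ^ ν * ‖v n - v₀‖) atTop (𝓝 0))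
    (ht : Tendsto (fun n : ℕ => (n : ℝ) ^ ν * |t n - t₀|) atTop (𝓝 0)) :
    Tendsto (fun n : ℕ => (n : ℝ) ^ ν * ‖(a n - t n • v n) - (a₀ - t₀ • v₀)‖) atTop (𝓝 0) := by
  have hvt : Tendsto v atTop (𝓝 v₀) := tendsto_iff_norm_sub_tendsto_zero.2
    (tendsto_zero_of_rpow_mul hν (fun n => norm_nonneg _) hv)
  have hlim := (ha.add (ht.mul hvt.norm)).add (hv.const_mul |t₀|)
  simp only [zero_mul, mul_zero, add_zero] at hlim
  refine squeeze_zero (fun n => by positivity) (fun n => ?_) hlim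
  have hn : (0 : ℝ) ≤ (n : ℝ) ^ ν := by positivity
  have h1 : (a n - t n • v n) - (a₀ - t₀ • v₀) =
      ((a n - a₀) - (t n - t₀) • v n) - t₀ • (v n - v₀) := by
    simp only [sub_smul, smul_sub]; abel
  have h2 : ‖(a n - t n • v n) - (a₀ - t₀ • v₀)‖ ≤
      ‖a n - a₀‖ + |t n - t₀| * ‖v n‖ + |t₀| * ‖v n - v₀‖ := by
    rw [h1]
    refine (norm_sub_le _ _).trans (add_le_add ((norm_sub_le _ _).trans ?_) ?_)
    · rw [norm_smul, Real.norm_eq_abs]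
    · rw [norm_smul, Real.norm_eq_abs]
  calc _ ≤ (n : ℝ) ^ ν * (‖a n - a₀‖ + |t n - t₀| * ‖v n‖ + |t₀| * ‖v n - v₀‖) := by gcongr
    _ = _ := by ring

end Centering

end KPLS

/-- Here `P` is the joint distribution of `(X, Y)`, `P.fst` the marginal of `X`, and
`Z 0, Z 1, …` are independent observations with law `P`. The first part takes the observed
responses as they are, the second one centres them empirically, in which case the target is
centred as well (it is the regression function itself if `Y` has mean zero). -/
theorem mainTheorem4
    {X : Type*} [MeasurableSpace X]
    (H : Type*) [NormedAddCommGroup H] [InnerProductSpace ℝ H] [CompleteSpace H] [RKHS ℝ H X ℝ]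
    (hk : Measurable (fun p : X × X => KPLS.realKernel H p.1 p.2))
    (P : Measure (X × ℝ)) [IsProbabilityMeasure P]
    (hBY : ∀ᵐ z ∂P, z.2 ∈ Set.Icc (-1 : ℝ) 1)
    (hBk : ∀ x : X, KPLS.realKernel H x x ≤ 1)
    (hU : KPLS.IsUniversal H (X := X))
    {Ω : Type*} [MeasurableSpace Ω] (μ : Measure Ω) [IsProbabilityMeasure μ]
    (Z : ℕ → Ω → X × ℝ)
    (hZ : ∀ i, Measurable (Z i))
    (hlaw : ∀ i, μ.map (Z i) = P)
    (hindep : iIndepFun Z μ)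
    (ν : ℝ) (hν0 : 0 < ν) (hν : ν < 1 / 2) :
    (∀ᵐ ω ∂μ, Tendsto
      (fun n : ℕ => eLpNorm
        (fun t : X => KPLS.regression P t -
          KPLS.estimate H ν (fun i : Fin n => (Z i ω).1) (fun i : Fin n => (Z i ω).2) t)
        2 P.fst)
      atTop (𝓝 0)) ∧
    (∀ᵐ ω ∂μ, Tendsto
      (fun n : ℕ => eLpNorm
        (fun t : X => (KPLS.regression P t - ∫ z, z.2 ∂P) -
          KPLS.estimate H ν (fun i : Fin n => (Z i ω).1)
            (KPLS.center (fun i : Fin n => (Z i ω).2)) t)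
        2 P.fst)
      atTop (𝓝 0)) := by
  -- The averaging theorem needs a bound everywhere, but `Y` is bounded only almost surely;
  -- truncation almost surely alters no observation.
  have hclip : ∀ᵐ ω ∂μ, ∀ i, KPLS.clip (Z i ω) = (Z i ω).2 := by
    rw [ae_all_iff]
    intro i
    rw [← hlaw i] at hBY
    filter_upwards [ae_of_ae_map (hZ i).aemeasurable hBY] with ω hω
    exact KPLS.clip_eq hω
  have hclipP : ∀ᵐ z ∂P, KPLS.clip z = z.2 := by
    filter_upwards [hBY] with z hz
    exact KPLS.clip_eq hz
  have hreg := KPLS.memLp_regression hBY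
  have hone : MemLp (fun _ : X => (1 : ℝ)) 2 P.fst := memLp_const 1
  have hS := KPLS.ae_tendsto_empCovL (P := P) (μ := μ) hk hBk hZ hlaw hindep hν
  have hb := KPLS.ae_tendsto_empAdj (P := P) (μ := μ) (H := H) hk hBk KPLS.measurable_clip
    KPLS.abs_clip_le hreg (fun g => by
      rw [KPLS.integral_regression_mul hBY (KPLS.measurable_coe hk g) (KPLS.abs_apply_le hBk g)]
      refine integral_congr_ae ?_
      filter_upwards [hclipP] with z hz
      rw [hz]) hZ hlaw hindep hν
  have hb1 := KPLS.ae_tendsto_empAdj (P := P) (μ := μ) (H := H) hk hBk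
    (c := fun _ => 1) measurable_const (fun _ => by simp) hone (fun g => by
      exact (integral_map (f := fun x => 1 * g x) measurable_fst.aemeasurable
        (measurable_const.mul (KPLS.measurable_coe hk g)).aestronglyMeasurable).symm)
      hZ hlaw hindep hν
  have hmean := KPLS.ae_tendsto_average (P := P) (μ := μ) KPLS.measurable_clip
    KPLS.abs_clip_le hZ hlaw hindep hν
  rw [integral_congr_ae hclipP] at hmean
  constructor
  · filter_upwards [hS, hb, hclip] with ω h1 h2 h3
    simp only [h3] at h2
    exact KPLS.tendsto_eLpNorm_sub_estimate hk hBk hU P.fst hreg hν0 _ _ h1 h2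
  · filter_upwards [hS, hb, hb1, hmean, hclip] with ω h1 h2 h3 h4 h5
    simp only [h5] at h2 h4
    -- The centred `T* y` tends to `J* f - (E Y) J* 1`, which is `J*` of the centred regression
    -- function.
    have h6 := KPLS.tendsto_rate_sub_smul hν0 h2 h3 h4
    have hF : MemLp (fun t : X => KPLS.regression P t - ∫ z, z.2 ∂P) 2 P.fst :=
      hreg.sub (memLp_const _)
    refine KPLS.tendsto_eLpNorm_sub_estimate hk hBk hU P.fst hF hν0 _ _ h1 ?_
    refine h6.congr fun n => ?_
    have h7 : hF.toLp _ = hreg.toLp _ - (∫ z, z.2 ∂P) • hone.toLp _ := by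
      rw [← MemLp.toLp_const_smul, ← MemLp.toLp_sub]
      refine MemLp.toLp_congr _ _ (Eventually.of_forall fun t => ?_)
      simp
    rw [KPLS.empAdj_center, h7, map_sub, map_smul]
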